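/- Work over the max-plus semiring $\mathbb{R}\cup\{-\infty\}$ (sum $\oplus=\max$, product $\otimes=+$, zero $-\infty$, unity $0$), with max-plus matrix products and powers, $A^0=I$, and $\mu^{\otimes t}=t\mu$. For an $n\times n$ matrix $A$ ($n\ge 1$) let $\mathcal{D}(A)$ be the digraph on $\{1,\dots,n\}$ with an edge $(i,j)$ of weight $a_{ij}$ whenever $a_{ij}\neq-\infty$. Let $\lambda(A)$ be the maximum mean weight (weight divided by length) of the nonempty cycles of $\mathcal{D}(A)$ ($-\infty$ if there are none), and let the critical graph $\mathcal{C}(A)$ consist of all nodes and edges on nonempty closed walks of mean weight $\lambda(A)$. Let $\gamma$ be the cyclicity of $\mathcal{C}(A)$, i.e. the least common multiple, over its strongly connected components (s.c.c.), of the greatest common divisors of the lengths of their closed walks; for a matrix $X$ let $X^*=I\oplus X\oplus X^2\oplus\cdots$, and put $M=\big((-\lambda(A)\otimes A)^{\gamma}\big)^*$. Define $C,S,R$ by $c_{ij}=m_{ij}$ if $j$ is a node of $\mathcal{C}(A)$, $r_{ij}=m_{ij}$ if $i$ is a node of $\mathcal{C}(A)$, $s_{ij}=-\lambda(A)\otimes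 a_{ij}$ if $(i,j)$ is an edge of $\mathcal{C}(A)$, all other entries being $-\infty$. If $\lambda(A)=-\infty$, then $\mathcal{C}(A)$ is empty and all entries of $C,S,R$ are $-\infty$. For a matrix $B$, $T_1(A,B)$ denotes the smallest integer $T\ge 0$ such that $$A^t=\big(\lambda(A)^{\otimes t}\otimes CS^tR\big)\oplus B^t\qquad\text{for all } t\ge T .$$ The matrix $B_{ct}$ is defined as follows. For $\mu\in\mathbb{R}\cup\{-\infty\}$ let $\mathcal{T}(\mu)$ be the graph of all nodes and edges of the nonempty cycles of $\mathcal{D}(A)$ with mean weight at least $\mu$. Let $\mu^{ct}$ be the greatest $\mu\le\lambda(A)$ such that $\mathcal{T}(\mu)$ has an s.c.c. containing no s.c.c. of $\mathcal{C}(A)$, and let $\mathcal{G}=\mathcal{T}(\mu^{ct})$; if there is no such $\mu$, put $\mu^{ct}=-\infty$ and $\mathcal{G}=\mathcal{D}(A)$. Then $B_{ct}$ is obtained from $A$ by setting to $-\infty$ all rows and columns whose index is a node of an s.c.c. of $\mathcal{G}$ that intersects $\mathcal{C}(A)$. **Theorem.** For every $n\ge 1$ and every $n\times n$ matrix $A$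 over $\mathbb{R}\cup\{-\infty\}$, the number $T_1(A,B_{ct})$ exists and satisfies $$T_1(A,B_{ct})\le W(n),\qquad T_1(A,B_{ct})\le (n-1)c+\min(n,\,d+c+1),\qquad T_1(A,B_{ct})\le (d+c-1)c+d+1,$$ where $W(1)=0$ and $W(n)=(n-1)^2+1$ for $n>1$, $c$ is the circumference of $\mathcal{D}(A)$ (the greatest length of a cycle, $0$ if there is none), and $d$ is its cab driver's diameter (the greatest length of a path, i.e. of a walk without repeated nodes). -/

import Mathlib

namespace MaxPlus

/-- Square matrices over the max-plus semiring `ℝ ∪ {-∞}`: the max-plus zero `-∞` is `⊥`, the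
max-plus sum is `max`, the max-plus product is `+`, and the max-plus unity is the real number `0`.
The semiring instances of `Matrix` are not used; all products below are max-plus products. -/
abbrev Mat (n : ℕ) : Type := Matrix (Fin n) (Fin n) (WithBot ℝ)

section Algebra

variable {n : ℕ}

/-- Max-plus matrix product, `(A B)_{ij} = max_k (a_{ik} + b_{kj})`. -/
noncomputable def mul (A B : Mat n) : Mat n :=
  fun i j => Finset.univ.sup fun k => A i k + B k j

/-- Max-plus sum of matrices (entrywise maximum). -/
noncomputable def oplus (A B : Mat n) : Mat n := fun i j => A i j ⊔ B i j

/-- Max-plus identity matrix. -/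
noncomputable def one (n : ℕ) : Mat n := fun i j => if i = j then 0 else ⊥

/-- Max-plus matrix powers, with `A^0 = I`. -/
noncomputable def pow (A : Mat n) : ℕ → Mat n
  | 0 => one n
  | t + 1 => mul (pow A t) A

/-- Max-plus multiplication of a matrix by a scalar. -/
noncomputable def smul (c : WithBot ℝ) (A : Mat n) : Mat n := fun i j => c + A i j

/-- Max-plus inverse of a scalar: `-x` for real `x` (and the unused convention `⊥` at `⊥`). -/
noncomputable def inv (c : WithBot ℝ) : WithBot ℝ := WithBot.map (fun x : ℝ => -x) c

/-- Kleene star `I ⊕ A ⊕ A² ⊕ ⋯`. -/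
noncomputable def star (A : Mat n) : Mat n := fun i j => ⨆ k : ℕ, pow A k i j

end Algebra

/-- A digraph (with loops allowed) whose nodes are some of the elements of `Fin n`. -/
structure Digr (n : ℕ) where
  nodes : Set (Fin n)
  edge : Fin n → Fin n → Prop
  left_mem : ∀ {i j}, edge i j → i ∈ nodes
  right_mem : ∀ {i j}, edge i j → j ∈ nodes

namespace Digr

variable {n : ℕ}

/-- `H` is a subgraph of `G`. -/
def IsSubgraph (H G : Digr n) : Prop :=
  H.nodes ⊆ G.nodes ∧ ∀ i j, H.edge i j → G.edge i j

/-- A walk `(i_0, …, i_L)` of `G`, given as the list of its nodes. -/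
def IsWalk (G : Digr n) (W : List (Fin n)) : Prop :=
  W ≠ [] ∧ (∀ v ∈ W, v ∈ G.nodes) ∧ W.IsChain G.edge

/-- The number of edges of a walk. -/
def len (W : List (Fin n)) : ℕ := W.length - 1

/-- A closed walk (possibly the empty one, of length `0`, at a node). -/
def IsClosedWalk (G : Digr n) (W : List (Fin n)) : Prop :=
  G.IsWalk W ∧ W.head? = W.getLast?

/-- A nonempty cycle: a closed walk of positive length without repeated nodes, except that its
first node is also its last one. -/
def IsCycle (G : Digr n) (W : List (Fin n)) : Prop :=
  G.IsClosedWalk W ∧ 1 ≤ len W ∧ W.tail.Nodup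

/-- A path: a walk without repeated nodes. -/
def IsPath (G : Digr n) (W : List (Fin n)) : Prop :=
  G.IsWalk W ∧ W.Nodup

/-- Circumference: the greatest length of a cycle (`0` if there is no cycle). -/
noncomputable def circumference (G : Digr n) : ℕ :=
  sSup {L | ∃ Z, G.IsCycle Z ∧ len Z = L}

/-- Cab driver's diameter: the greatest length of a path. -/
noncomputable def cabDiameter (G : Digr n) : ℕ :=
  sSup {L | ∃ P, G.IsPath P ∧ len P = L}

/-- The strongly connected component of `G` that contains the node `v`: the subgraph induced by
the nodes `w` such that there are walks from `v` to `w` and from `w` to `v`. -/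
def scc (G : Digr n) (v : Fin n) : Digr n where
  nodes := {w | w ∈ G.nodes ∧
    Relation.ReflTransGen G.edge v w ∧ Relation.ReflTransGen G.edge w v}
  edge i j := G.edge i j ∧
    (Relation.ReflTransGen G.edge v i ∧ Relation.ReflTransGen G.edge i v) ∧
    (Relation.ReflTransGen G.edge v j ∧ Relation.ReflTransGen G.edge j v)
  left_mem h := ⟨G.left_mem h.1, h.2.1⟩
  right_mem h := ⟨G.right_mem h.1, h.2.2⟩

/-- `H` is a strongly connected component of `G`. -/
def IsSCC (H G : Digr n) : Prop := ∃ v ∈ G.nodes, H = G.scc v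

/-- The greatest common divisor of the lengths of the closed walks of `G`. -/
noncomputable def closedWalkGcd (G : Digr n) : ℕ :=
  sSup {d | ∀ W, G.IsClosedWalk W → d ∣ len W}

open Classical in
/-- Cyclicity: the least common multiple, over the strongly connected components, of the greatest
common divisor of the lengths of the closed walks in the component. -/
noncomputable def cyclicity (G : Digr n) : ℕ :=
  (Finset.univ.filter fun v => v ∈ G.nodes).lcm fun v => (G.scc v).closedWalkGcd

end Digr

section Spectral

variable {n : ℕ}

/-- The digraph of a matrix: the nodes are all indices, the edges are the positions of the finite
entries. -/
def digraph (A : Mat n) : Digr n where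
  nodes := Set.univ
  edge i j := A i j ≠ ⊥
  left_mem _ := Set.mem_univ _
  right_mem _ := Set.mem_univ _

/-- The weight `a_{i_0 i_1} + a_{i_1 i_2} + ⋯` of a walk. -/
noncomputable def weight (A : Mat n) (W : List (Fin n)) : WithBot ℝ :=
  (List.zipWith (fun i j => A i j) W W.tail).sum

/-- The mean weight of a walk of positive length. -/
noncomputable def mean (A : Mat n) (W : List (Fin n)) : WithBot ℝ :=
  WithBot.map (fun x : ℝ => x / (Digr.len W : ℝ)) (weight A W)

/-- The maximum cycle mean `λ(A)`; it is `⊥` if the digraph of `A` has no cycle. -/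
noncomputable def maxCycleMean (A : Mat n) : WithBot ℝ :=
  sSup {m | ∃ Z, (digraph A).IsCycle Z ∧ mean A Z = m}

/-- A critical closed walk: a nonempty closed walk whose mean weight is `λ(A)`. -/
def IsCritical (A : Mat n) (Z : List (Fin n)) : Prop :=
  (digraph A).IsClosedWalk Z ∧ 1 ≤ Digr.len Z ∧ mean A Z = maxCycleMean A

/-- The critical graph: all nodes and edges on critical closed walks. -/
def critGraph (A : Mat n) : Digr n where
  nodes := {v | ∃ Z, IsCritical A Z ∧ v ∈ Z}
  edge i j := ∃ Z, IsCritical A Z ∧ [i, j] <:+: Z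
  left_mem := fun ⟨Z, hZ, h⟩ => ⟨Z, hZ, h.subset (by simp)⟩
  right_mem := fun ⟨Z, hZ, h⟩ => ⟨Z, hZ, h.subset (by simp)⟩

end Spectral

section CSR

variable {n : ℕ}

/-- The matrix `((λ(A)⁻ ⊗ A)^γ)^*`, where `γ` is the cyclicity of `G`. -/
noncomputable def csrM (A : Mat n) (G : Digr n) : Mat n :=
  star (pow (smul (inv (maxCycleMean A)) A) G.cyclicity)

open Classical in
/-- The term `C` of `A` with respect to the subgraph `G` of the critical graph. -/
noncomputable def csrC (A : Mat n) (G : Digr n) : Mat n :=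
  fun i j => if j ∈ G.nodes then csrM A G i j else ⊥

open Classical in
/-- The term `S` of `A` with respect to the subgraph `G` of the critical graph. -/
noncomputable def csrS (A : Mat n) (G : Digr n) : Mat n :=
  fun i j => if G.edge i j then inv (maxCycleMean A) + A i j else ⊥

open Classical in
/-- The term `R` of `A` with respect to the subgraph `G` of the critical graph. -/
noncomputable def csrR (A : Mat n) (G : Digr n) : Mat n :=
  fun i j => if i ∈ G.nodes then csrM A G i j else ⊥

/-- The matrix `C S^t R`, for the terms of `A` with respect to its critical graph. -/
noncomputable def csr (A : Mat n) (t : ℕ) : Mat n :=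
  mul (mul (csrC A (critGraph A)) (pow (csrS A (critGraph A)) t)) (csrR A (critGraph A))

/-- `T` is the weak CSR threshold `T_1(A, B)`: the smallest natural number `T` such that
`A^t = (λ(A)^{⊗ t} ⊗ C S^t R) ⊕ B^t` for all `t ≥ T`. Here `λ^{⊗ t}` is the ordinary multiple
`t • λ`. -/
def IsWeakCSRThreshold (A B : Mat n) (T : ℕ) : Prop :=
  IsLeast {T : ℕ | ∀ t, T ≤ t →
    pow A t = oplus (smul (t • maxCycleMean A) (csr A t)) (pow B t)} T

end CSR

section CycleThreshold

variable {n : ℕ}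

/-- The cycle threshold graph of level `μ`: all nodes and edges of the cycles of mean weight at
least `μ`. -/
def cycleThresholdGraph (A : Mat n) (μ : WithBot ℝ) : Digr n where
  nodes := {v | ∃ Z, ((digraph A).IsCycle Z ∧ μ ≤ mean A Z) ∧ v ∈ Z}
  edge i j := ∃ Z, ((digraph A).IsCycle Z ∧ μ ≤ mean A Z) ∧ [i, j] <:+: Z
  left_mem := fun ⟨Z, hZ, h⟩ => ⟨Z, hZ, h.subset (by simp)⟩
  right_mem := fun ⟨Z, hZ, h⟩ => ⟨Z, hZ, h.subset (by simp)⟩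

/-- The greatest `μ ≤ λ(A)` such that the cycle threshold graph of level `μ` has a strongly
connected component that contains no strongly connected component of the critical graph; it is `⊥`
if there is no such `μ`. (The supremum is attained: there are finitely many cycles.) -/
noncomputable def muCT (A : Mat n) : WithBot ℝ :=
  sSup {μ | μ ≤ maxCycleMean A ∧ ∃ H, Digr.IsSCC H (cycleThresholdGraph A μ) ∧
    ∀ K, Digr.IsSCC K (critGraph A) → ¬ K.IsSubgraph H}

open Classical in
/-- The cycle threshold graph of level `muCT A`, which is by convention the whole digraph of `A`
if `muCT A = ⊥`. -/
noncomputable def ctLevelGraph (A : Mat n) : Digr n :=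
  if muCT A = ⊥ then digraph A else cycleThresholdGraph A (muCT A)

/-- The nodes of the graph that defines the cycle threshold scheme, which is the union of the
strongly connected components of `ctLevelGraph A` that intersect the critical graph. -/
def ctNodes (A : Mat n) : Set (Fin n) :=
  {v | ∃ H, Digr.IsSCC H (ctLevelGraph A) ∧ (H.nodes ∩ (critGraph A).nodes).Nonempty ∧
    v ∈ H.nodes}

open Classical in
/-- The subordinate matrix of the cycle threshold scheme: the rows and columns of the nodes in
`ctNodes A` are set to `-∞`. -/
noncomputable def Bct (A : Mat n) : Mat n :=
  fun i j => if i ∈ ctNodes A ∨ j ∈ ctNodes A then ⊥ else A i j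

end CycleThreshold

/-- The Wielandt number. -/
def wielandt (n : ℕ) : ℕ := if n = 1 then 0 else (n - 1) ^ 2 + 1

end MaxPlus

/-! Entries of max-plus powers are greatest weights of walks, so the expansion compares walks of
length t. If λ(A) = -∞, nothing is critical, the CSR term is -∞ and `Bct A` is A. Otherwise subtract
λ(A) from all edges: no closed walk is positive any more, and the critical ones have weight zero.

The engine is cycle removal. A long enough walk meeting a cycle Z of length l can be shortened by a
positive multiple of l, still meeting Z and losing no weight; if Z has nonnegative weight, turns of
Z then restore the length. How long is long enough is recorded in `IsLarge`. Its bounds come from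
counting visits modulo l (`Conn.reduce_of_card`), from a finer count using that paths have length at
most d (`Conn.reduce_of_path`), from disjoint loops whose lengths have a zero-sum subfamily in Z/l
(`Conn.reduce_of_loops`), and, for the Wielandt number when Z is Hamiltonian, from the structure of
zero-sum free sequences in Z/n (`HasWalk.reduce_hamiltonian`).

The CSR term is at most the power (`csr_le_pow`): an entry of CS^tR is a supremum over walks through
a critical node x, of lengths exceeding t by multiples of γ. Critical closed walks inserted at x
make the length congruent to t modulo a critical cycle through x; removing cycles and adding turns
gives length exactly t.

Conversely, a walk avoiding `ctNodes A` is counted by `Bct A`. For any other walk,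
`Conn.exists_critical` finds a walk with the same ends and length, at least as heavy, through a
critical node, hence dominated by CSR (`coe_le_csr`). It moves along a path to the critical graph
whose edges lie on cycles of mean at least ν. While the cycles of the walk have mean at most ν,
subtracting ν lets cycle removal trade them for turns of the next cycle on that path
(`Conn.reroute`). If the walk has a cycle of larger mean, the argument restarts at that level, where
the definition of `muCT` again provides a path to a critical node. -/

namespace MaxPlus

/-! ### Weighted walks and irreducible connections through a node set -/

section Walks

variable {V : Type*}

/-- There is a walk from `i` to `j` with `L` steps along `E` and total weight `w`. -/
inductive HasWalk (E : V → V → Prop) (a : V → V → ℝ) : V → V → ℕ → ℝ → Prop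
  | nil (i : V) : HasWalk E a i i 0 0
  | cons {i j k : V} {L : ℕ} {w : ℝ} :
      E i j → HasWalk E a j k L w → HasWalk E a i k (L + 1) (a i j + w)

variable {E : V → V → Prop} {a : V → V → ℝ}

namespace HasWalk

theorem cast {i j : V} {L L' : ℕ} {w w' : ℝ} (h : HasWalk E a i j L w) (hL : L = L')
    (hw : w = w') : HasWalk E a i j L' w' := hL ▸ hw ▸ h

theorem single {i j : V} (h : E i j) : HasWalk E a i j 1 (a i j) :=
  (cons h (nil j)).cast rfl (add_zero _)

theorem trans {i j k : V} {L L' : ℕ} {w w' : ℝ} (h : HasWalk E a i j L w)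
    (h' : HasWalk E a j k L' w') : HasWalk E a i k (L + L') (w + w') := by
  induction h with
  | nil i => simpa using h'
  | cons e _ ih => exact (cons e (ih h')).cast (by omega) (by ring)

/-- The potential `h` telescopes along the walk and leaves only its end values; `c` is charged once
per step. -/
theorem reweight {E' : V → V → Prop} {a' : V → V → ℝ} (h : V → ℝ) (c : ℝ)
    (hE : ∀ u v, E u v → E' u v)
    (ha : ∀ u v, E u v → a' u v = a u v + h u - h v - c) {i j : V} {L : ℕ} {w : ℝ}
    (H : HasWalk E a i j L w) : HasWalk E' a' i j L (w + h i - h j - c * L) := by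
  induction H with
  | nil i => exact (nil i).cast rfl (by simp)
  | cons e _ ih =>
    exact (cons (hE _ _ e) ih).cast rfl (by rw [ha _ _ e]; push_cast; ring)

theorem mono {E' : V → V → Prop} (hE : ∀ u v, E u v → E' u v) {i j : V} {L : ℕ} {w : ℝ}
    (H : HasWalk E a i j L w) : HasWalk E' a i j L w :=
  (H.reweight (E' := E') (a' := a) 0 0 hE (by simp)).cast rfl (by simp)

theorem sub_const (c : ℝ) {i j : V} {L : ℕ} {w : ℝ} (H : HasWalk E a i j L w) :
    HasWalk E (fun u v => a u v - c) i j L (w - c * L) :=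
  (H.reweight (E' := E) (a' := fun u v => a u v - c) 0 c (fun _ _ h => h) (by simp)).cast rfl
    (by simp)

theorem of_sub_const (c : ℝ) {i j : V} {L : ℕ} {w : ℝ}
    (H : HasWalk E (fun u v => a u v - c) i j L w) : HasWalk E a i j L (w + c * L) :=
  (H.reweight (E' := E) (a' := a) 0 (-c) (fun _ _ h => h) (by simp)).cast rfl (by simp)

theorem comap {V' : Type*} {E' : V' → V' → Prop} {a' : V' → V' → ℝ} (e : V → V')
    (hE : ∀ u v, E u v → E' (e u) (e v)) (ha : ∀ u v, E u v → a' (e u) (e v) = a u v)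
    {i j : V} {L : ℕ} {w : ℝ} (H : HasWalk E a i j L w) : HasWalk E' a' (e i) (e j) L w := by
  induction H with
  | nil i => exact nil _
  | cons h _ ih => exact (cons (hE _ _ h) ih).cast rfl (by rw [ha _ _ h])

theorem ofFun {f : ℕ → V} {x y : ℕ} (hxy : x ≤ y)
    (hf : ∀ s, x ≤ s → s < y → E (f s) (f (s + 1))) :
    HasWalk E a (f x) (f y) (y - x) (∑ s ∈ Finset.Ico x y, a (f s) (f (s + 1))) := by
  induction y, hxy using Nat.le_induction with
  | base => simpa using nil (f x)
  | succ y hxy ih =>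
    have h1 := ih fun s h h' => hf s h (by omega)
    refine (h1.trans (single (hf y hxy (by omega)))).cast (by omega) ?_
    rw [Finset.sum_Ico_succ_top hxy]

theorem exists_fun {i j : V} {L : ℕ} {w : ℝ} (H : HasWalk E a i j L w) :
    ∃ f : ℕ → V, f 0 = i ∧ f L = j ∧ (∀ s < L, E (f s) (f (s + 1))) ∧
      ∑ s ∈ Finset.Ico 0 L, a (f s) (f (s + 1)) = w := by
  induction H with
  | nil i => exact ⟨fun _ => i, rfl, rfl, by simp, by simp⟩
  | @cons i j k L w e _ ih =>
    obtain ⟨f, h0, hL, hs, hw⟩ := ih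
    refine ⟨fun s => if s = 0 then i else f (s - 1), by simp, by simp [hL], ?_, ?_⟩
    · intro s hsL
      rcases Nat.eq_zero_or_pos s with rfl | hp
      · simpa [h0] using e
      · have := hs (s - 1) (by omega)
        rw [show s - 1 + 1 = s by omega] at this
        simpa [hp.ne'] using this
    · rw [← Finset.range_eq_Ico, Finset.sum_range_succ', add_comm, ← hw, ← Finset.range_eq_Ico]
      simp [h0]

theorem iterate {i : V} {L : ℕ} {w : ℝ} (H : HasWalk E a i i L w) (m : ℕ) :
    HasWalk E a i i (m * L) (m * w) := by
  induction m with
  | zero => exact (nil i).cast (by simp) (by simp)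
  | succ m ih => exact (ih.trans H).cast (by ring) (by push_cast; ring)

/-- The excised segment is a closed walk, hence nonpositive, so cutting it out cannot lower the
weight. -/
theorem remove_loop (hneg : ∀ v L w, HasWalk E a v v L w → w ≤ 0) {f : ℕ → V} {L x y : ℕ}
    (hf : ∀ s < L, E (f s) (f (s + 1))) (hxy : x ≤ y) (hy : y ≤ L) (hv : f x = f y) :
    ∃ w', ∑ s ∈ Finset.Ico 0 L, a (f s) (f (s + 1)) ≤ w' ∧
      HasWalk E a (f 0) (f L) (L - (y - x)) w' := by
  have h1 : HasWalk E a (f 0) (f x) (x - 0) _ := ofFun (Nat.zero_le x) fun s _ h => hf s (by omega)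
  have h2 : HasWalk E a (f x) (f y) (y - x) _ := ofFun hxy fun s _ h => hf s (by omega)
  have h3 : HasWalk E a (f y) (f L) (L - y) _ := ofFun hy fun s _ h => hf s (by omega)
  rw [← hv] at h2 h3
  refine ⟨_, ?_, (h1.trans h3).cast (by omega) rfl⟩
  have := hneg _ _ _ h2
  rw [← Finset.sum_Ico_consecutive _ (Nat.zero_le x) (hxy.trans hy),
    ← Finset.sum_Ico_consecutive _ hxy hy]
  linarith

/-- A closed walk all of whose simple subcycles have nonpositive weight has nonpositive weight. -/
theorem nonpos_of_simple
    (h : ∀ (f : ℕ → V) (L : ℕ), 1 ≤ L → f 0 = f L → (∀ s < L, E (f s) (f (s + 1))) →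
      (∀ x < L, ∀ y < L, f x = f y → x = y) →
      ∑ s ∈ Finset.Ico 0 L, a (f s) (f (s + 1)) ≤ 0)
    (v : V) (L : ℕ) (w : ℝ) (H : HasWalk E a v v L w) : w ≤ 0 := by
  induction L using Nat.strong_induction_on generalizing v w with
  | _ L ih =>
    rcases Nat.eq_zero_or_pos L with rfl | hL
    · cases H; rfl
    obtain ⟨f, h0, h1, hs, rfl⟩ := H.exists_fun
    by_cases hinj : ∀ x < L, ∀ y < L, f x = f y → x = y
    · exact h f L hL (h0.trans h1.symm) hs hinj
    · have : ∃ x y, x < y ∧ y < L ∧ f x = f y := by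
        push Not at hinj
        obtain ⟨x, hx, y, hy, hxy, hne⟩ := hinj
        rcases lt_or_gt_of_ne hne with h | h
        · exact ⟨x, y, h, hy, hxy⟩
        · exact ⟨y, x, h, hx, hxy.symm⟩
      obtain ⟨x, y, hxy, hy, hv⟩ := this
      -- A repeated node splits the closed walk into two shorter closed walks, both covered by
      -- induction.
      have h1' : HasWalk E a (f 0) (f x) (x - 0) _ :=
        ofFun (Nat.zero_le x) fun s _ h => hs s (by omega)
      have h2 : HasWalk E a (f x) (f y) (y - x) _ := ofFun hxy.le fun s _ h => hs s (by omega)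
      have h3 : HasWalk E a (f y) (f L) (L - y) _ := ofFun hy.le fun s _ h => hs s (by omega)
      rw [← hv] at h2 h3
      have h4 := h1'.trans h3
      rw [h0, h1] at h4
      have := ih _ (by omega) _ _ h2
      have := ih _ (by omega) _ _ h4
      rw [← Finset.sum_Ico_consecutive _ (Nat.zero_le x) (hxy.le.trans hy.le),
        ← Finset.sum_Ico_consecutive _ hxy.le hy.le]
      linarith

end HasWalk

/-- There is a walk from `i` to `j` with `t` steps, visiting `N`, of weight at least `w`. -/
def Conn (E : V → V → Prop) (a : V → V → ℝ) (N : Finset V) (i j : V) (t : ℕ) (w : ℝ) : Prop :=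
  ∃ k ∈ N, ∃ p q u v, HasWalk E a i k p u ∧ HasWalk E a k j q v ∧ p + q = t ∧ w ≤ u + v

theorem Conn.ofFun {N : Finset V} {f : ℕ → V} {t p : ℕ} (hp : p ≤ t) (hN : f p ∈ N)
    (hf : ∀ s < t, E (f s) (f (s + 1))) {w : ℝ}
    (hw : w ≤ ∑ s ∈ Finset.Ico 0 t, a (f s) (f (s + 1))) : Conn E a N (f 0) (f t) t w := by
  refine ⟨f p, hN, p - 0, t - p, _, _, HasWalk.ofFun (Nat.zero_le p) fun s _ h => hf s (by omega),
    HasWalk.ofFun hp fun s _ h => hf s (by omega), by omega, ?_⟩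
  rwa [Finset.sum_Ico_consecutive _ (Nat.zero_le p) hp]

theorem Conn.hasWalk {N : Finset V} {i j : V} {t : ℕ} {w : ℝ} (h : Conn E a N i j t w) :
    ∃ w', w ≤ w' ∧ HasWalk E a i j t w' := by
  obtain ⟨k, _, p, q, u, v, h1, h2, h3, h4⟩ := h
  exact ⟨_, h4, (h1.trans h2).cast h3 rfl⟩

/-- An irreducible connection has a representative whose first part cannot be shortened, even by
moving loops to its second part. -/
theorem Conn.exists_irreducible (hneg : ∀ v L w, HasWalk E a v v L w → w ≤ 0) {N : Finset V}
    {l : ℕ} {i j : V} {t : ℕ} {w : ℝ} (h : Conn E a N i j t w)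
    (hirr : ¬ ∃ t' < t, t' ≡ t [MOD l] ∧ Conn E a N i j t' w) :
    ∃ (p q : ℕ) (f g : ℕ → V), p + q = t ∧ f 0 = i ∧ f p = g 0 ∧ g q = j ∧ g 0 ∈ N ∧
      (∀ s < p, E (f s) (f (s + 1))) ∧ (∀ s < q, E (g s) (g (s + 1))) ∧
      (∀ s < p, f s ∉ N) ∧
      (∀ x y, x < y → y ≤ p → f x = f y → ¬ l ∣ y - x) ∧
      (∀ x y, x < y → y ≤ q → g x = g y → ¬ l ∣ y - x) ∧
      (∀ x y s, x < y → y ≤ p → s ≤ q → f x = f y → g s ≠ f x) ∧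
      (∀ x y x' y', x < y → y ≤ p → x' < y' → y' ≤ q → f x = f y → g x' = g y' →
        ¬ l ∣ (y - x) + (y' - x')) := by
  classical
  -- Among all representatives of the connection, take one whose first part is shortest.
  have hex : ∃ p, ∃ k ∈ N, ∃ q u v, HasWalk E a i k p u ∧ HasWalk E a k j q v ∧ p + q = t ∧
      w ≤ u + v := by
    obtain ⟨k, hk, p, q, u, v, h⟩ := h
    exact ⟨p, k, hk, q, u, v, h⟩
  have hmin := fun m => @Nat.find_min _ _ hex m
  obtain ⟨k, hk, q, u, v, hu, hv, hpq, hw⟩ := Nat.find_spec hex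
  generalize Nat.find hex = p at *
  obtain ⟨f, f0, fp, fs, rfl⟩ := hu.exists_fun
  obtain ⟨g, g0, gq, gs, rfl⟩ := hv.exists_fun
  have hmod : ∀ r, l ∣ r → r ≤ t → t - r ≡ t [MOD l] := fun r hr hrt =>
    (Nat.modEq_iff_dvd' (by omega)).2 (by rwa [Nat.sub_sub_self hrt])
  refine ⟨p, q, f, g, hpq, f0, fp.trans g0.symm, gq, g0 ▸ hk, fs, gs, ?_, ?_, ?_, ?_, ?_⟩
  -- An earlier visit of `N` would be an earlier splitting point, contradicting minimality of `p`.
  · intro s hs hN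
    have h1 : HasWalk E a (f 0) (f s) (s - 0) _ :=
      HasWalk.ofFun (Nat.zero_le s) fun r _ h => fs r (by omega)
    have h2 : HasWalk E a (f s) (f p) (p - s) _ := HasWalk.ofFun hs.le fun r _ h => fs r (by omega)
    rw [f0] at h1
    rw [fp] at h2
    refine hmin s hs ⟨f s, hN, (p - s) + q, _, _, h1.cast (by omega) rfl, h2.trans hv, by omega, ?_⟩
    rw [← Finset.sum_Ico_consecutive _ (Nat.zero_le s) hs.le] at hw
    linarith
  · intro x y hxy hy hv' hd
    obtain ⟨w', hw', H⟩ := HasWalk.remove_loop hneg fs hxy.le hy hv'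
    rw [f0, fp] at H
    exact hirr ⟨t - (y - x), by omega, hmod _ hd (by omega), k, hk, _, q, _, _, H, hv, by omega,
      by linarith⟩
  · intro x y hxy hy hv' hd
    obtain ⟨w', hw', H⟩ := HasWalk.remove_loop hneg gs hxy.le hy hv'
    rw [g0, gq] at H
    exact hirr ⟨t - (y - x), by omega, hmod _ hd (by omega), k, hk, p, _, _, _, hu, H, by omega,
      by linarith⟩
  -- A loop of the first part at a node that the second part also visits can be moved there: length
  -- and weight are unchanged, but `p` drops.
  · intro x y s hxy hy hs hv' hg
    have h1 : HasWalk E a (f 0) (f x) (x - 0) _ :=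
      HasWalk.ofFun (Nat.zero_le x) fun s _ h => fs s (by omega)
    have h2 : HasWalk E a (f x) (f y) (y - x) _ :=
      HasWalk.ofFun hxy.le fun s _ h => fs s (by omega)
    have h3 : HasWalk E a (f y) (f p) (p - y) _ := HasWalk.ofFun hy fun s _ h => fs s (by omega)
    have h4 : HasWalk E a (g 0) (g s) (s - 0) _ :=
      HasWalk.ofFun (Nat.zero_le s) fun s _ h => gs s (by omega)
    have h5 : HasWalk E a (g s) (g q) (q - s) _ := HasWalk.ofFun hs fun s _ h => gs s (by omega)
    rw [← hv'] at h2 h3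
    rw [hg] at h4 h5
    rw [f0] at h1
    rw [fp] at h3
    rw [g0] at h4
    rw [gq] at h5
    refine hmin (p - (y - x)) (by omega) ⟨k, hk, q + (y - x), _, _,
      (h1.trans h3).cast (by omega) rfl, ((h4.trans h2).trans h5).cast (by omega) rfl, by omega, ?_⟩
    rw [← Finset.sum_Ico_consecutive _ (Nat.zero_le x) (hxy.le.trans hy),
      ← Finset.sum_Ico_consecutive _ hxy.le hy,
      ← Finset.sum_Ico_consecutive _ (Nat.zero_le s) hs] at hw
    linarith
  · intro x y x' y' hxy hy hxy' hy' hv1 hv2 hd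
    obtain ⟨w1, hw1, H1⟩ := HasWalk.remove_loop hneg fs hxy.le hy hv1
    obtain ⟨w2, hw2, H2⟩ := HasWalk.remove_loop hneg gs hxy'.le hy' hv2
    rw [f0, fp] at H1
    rw [g0, gq] at H2
    exact hirr ⟨t - ((y - x) + (y' - x')), by omega, hmod _ hd (by omega), k, hk, _, _, _, _, H1,
      H2, by omega, by linarith⟩

end Walks

/-! ### Shortening walks modulo l: visit counts, paths, disjoint loops -/

section Reduction

variable {V : Type*} {E : V → V → Prop} {a : V → V → ℝ}

/-- Two visits of `v` at times congruent modulo `l` would enclose a loop of length divisible by `l`,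
so visits have distinct residues. -/
theorem card_fiber_le [DecidableEq V] {f : ℕ → V} {m l : ℕ} (hl : 1 ≤ l)
    (h : ∀ x y, x < y → y < m → f x = f y → ¬ l ∣ y - x) (v : V) :
    ((Finset.range m).filter fun s => f s = v).card ≤ l := by
  have : ∀ x y, x < y → y < m → f x = f y → x % l ≠ y % l := fun x y hxy hy hv he =>
    h x y hxy hy hv ((Nat.modEq_iff_dvd' hxy.le).1 he)
  refine (Finset.card_le_card_of_injOn (t := Finset.range l) (fun s => s % l) ?_ ?_).trans_eq
    (Finset.card_range l)
  · intro s _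
    simpa using Nat.mod_lt _ hl
  · intro x hx y hy hxy
    simp only [Finset.coe_filter, Finset.mem_range, Set.mem_ofPred_eq] at hx hy
    rcases lt_trichotomy x y with hlt | he | hlt
    · exact absurd hxy (this x y hlt hy.1 (hx.2.trans hy.2.symm))
    · exact he
    · exact absurd hxy.symm (this y x hlt hx.1 (hy.2.trans hx.2.symm))

/-- If the residues modulo `l` of the times of the visits of `v` are pairwise different and take all
values, then each residue is the length of a loop at `v`. -/
theorem exists_loop_of_card_fiber_eq [DecidableEq V] {f : ℕ → V} {m l : ℕ} (hl : 1 ≤ l)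
    (h : ∀ x y, x < y → y < m → f x = f y → ¬ l ∣ y - x) (v : V)
    (hv : l ≤ ((Finset.range m).filter fun s => f s = v).card) {r : ℕ} (hr : ¬ l ∣ r) :
    ∃ x y, x < y ∧ y < m ∧ f x = v ∧ f y = v ∧ l ∣ r + (y - x) := by
  classical
  set F := (Finset.range m).filter fun s => f s = v with hF
  have hne : F.Nonempty := Finset.card_pos.1 (by omega)
  set x := F.min' hne
  have hx : x ∈ F := F.min'_mem hne
  have hxl : ∀ y ∈ F, x ≤ y := fun y hy => F.min'_le y hy
  have hinj : Set.InjOn (fun s => (s - x) % l) F := by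
    have : ∀ y ∈ F, ∀ z ∈ F, y < z → (y - x) % l ≠ (z - x) % l := by
      intro y hy z hz hyz he
      have h1 := hxl y hy
      have h2 := (Nat.modEq_iff_dvd' (by omega : y - x ≤ z - x)).1 he
      simp only [hF, Finset.mem_filter, Finset.mem_range] at hy hz
      refine h y z hyz hz.1 (hy.2.trans hz.2.symm) ?_
      rwa [show z - y = z - x - (y - x) by omega]
    intro y hy z hz hyz
    rcases lt_trichotomy y z with hlt | he | hlt
    · exact absurd hyz (this y hy z hz hlt)
    · exact he
    · exact absurd hyz.symm (this z hz y hy hlt)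
  have himg : F.image (fun s => (s - x) % l) = Finset.range l := by
    refine Finset.eq_of_subset_of_card_le ?_ ?_
    · intro s hs
      obtain ⟨y, -, rfl⟩ := Finset.mem_image.1 hs
      simpa using Nat.mod_lt _ hl
    · rw [Finset.card_image_of_injOn hinj, Finset.card_range]
      exact hv
  -- This is the residue of `-r`. Times measured from the first visit realize all residues, this one
  -- included; it is nonzero because `l ∤ r`.
  have hrl : (l - r % l) ∈ Finset.range l := by
    have : 0 < r % l := Nat.pos_of_ne_zero fun h0 => hr (Nat.dvd_of_mod_eq_zero h0)
    simp only [Finset.mem_range]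
    omega
  rw [← himg] at hrl
  obtain ⟨y, hy, hyr⟩ := Finset.mem_image.1 hrl
  have hxy := hxl y hy
  have hd : l ∣ r + (y - x) := by
    have h1 := Nat.mod_lt r hl
    have h2 := Nat.div_add_mod r l
    have h3 := Nat.div_add_mod (y - x) l
    refine ⟨r / l + (y - x) / l + 1, ?_⟩
    rw [mul_add, mul_add, mul_one]
    omega
  simp only [hF, Finset.mem_filter, Finset.mem_range] at hx hy
  refine ⟨x, y, lt_of_le_of_ne hxy ?_, hy.1, hx.2, hy.2, hd⟩
  intro he
  rw [← he, Nat.sub_self] at hd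
  exact hr hd

/-- Reduction of walks on the node set `M`, modulo `l`, keeping a node of `N`. -/
theorem Conn.reduce_of_card [DecidableEq V]
    (hneg : ∀ v L w, HasWalk E a v v L w → w ≤ 0) {M N : Finset V}
    {l : ℕ} (hl : 1 ≤ l) {i j : V} (hi : i ∈ M) (hE : ∀ u v, E u v → v ∈ M) {t : ℕ} {w : ℝ}
    (h : Conn E a N i j t w) (ht : (M ∩ N).card * l + (M \ N).card * (l + 1) < t + 1) :
    ∃ t' < t, t' ≡ t [MOD l] ∧ Conn E a N i j t' w := by
  by_contra hirr
  obtain ⟨p, q, f, g, rfl, f0, fp, -, -, fs, gs, hN, h2, h3, h4, -⟩ :=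
    h.exists_irreducible hneg hirr
  have hfM : ∀ s ≤ p, f s ∈ M := by
    rintro (_ | s) hs
    · rwa [f0]
    · exact hE _ _ (fs s (by omega))
  have hgM : ∀ s ≤ q, g s ∈ M := by
    rintro (_ | s) hs
    · rw [← fp]; exact hfM p le_rfl
    · exact hE _ _ (gs s (by omega))
  have e1 := Finset.card_eq_sum_card_fiberwise (f := f) (s := Finset.range p) (t := M)
    (fun s hs => hfM s (Finset.mem_range.1 hs).le)
  -- The junction `f p = g 0` is counted in the second part only, so `p + (q + 1) = t + 1` positions
  -- are counted in all.
  have e2 := Finset.card_eq_sum_card_fiberwise (f := g) (s := Finset.range (q + 1)) (t := M)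
    (fun s hs => hgM s (Nat.lt_succ_iff.1 (Finset.mem_range.1 hs)))
  have bA := card_fiber_le (m := p) hl fun x y hxy hy => h2 x y hxy hy.le
  have bB := card_fiber_le (m := q + 1) hl fun x y hxy hy => h3 x y hxy (by omega)
  rw [Finset.card_range] at e1 e2
  -- A node of `N` occurs only in the second part. Any other node occurs at most once in the first
  -- part, which gives `l + 1`, or it has a loop there and is then absent from the second part.
  have key : ∑ v ∈ M, (((Finset.range p).filter fun s => f s = v).card +
      ((Finset.range (q + 1)).filter fun s => g s = v).card) ≤
      ∑ v ∈ M, if v ∈ N then l else l + 1 := by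
    refine Finset.sum_le_sum fun v _ => ?_
    have hA := bA v
    have hB := bB v
    split_ifs with hv
    · rw [Finset.filter_false_of_mem (s := Finset.range p), Finset.card_empty]
      · omega
      · rintro s hs rfl
        exact hN s (Finset.mem_range.1 hs) hv
    · by_cases h1 : ((Finset.range p).filter fun s => f s = v).card ≤ 1
      · omega
      · obtain ⟨x, hx, y, hy, hxy⟩ := Finset.one_lt_card.1 (not_le.1 h1)
        simp only [Finset.mem_filter, Finset.mem_range] at hx hy
        have : ∀ s ≤ q, g s ≠ v := by
          intro s hs
          rcases lt_or_gt_of_ne hxy with hlt | hlt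
          · exact hx.2 ▸ h4 x y s hlt hy.1.le hs (hx.2.trans hy.2.symm)
          · exact hy.2 ▸ h4 y x s hlt hx.1.le hs (hy.2.trans hx.2.symm)
        rw [Finset.filter_false_of_mem (s := Finset.range (q + 1)), Finset.card_empty]
        · omega
        · intro s hs
          exact this s (Nat.lt_succ_iff.1 (Finset.mem_range.1 hs))
  rw [Finset.sum_add_distrib, ← e1, ← e2, Finset.sum_ite, Finset.sum_const, Finset.sum_const,
    Finset.filter_mem_eq_inter, smul_eq_mul, smul_eq_mul,
    show M.filter (fun v => v ∉ N) = M \ N from (Finset.sdiff_eq_filter M N).symm] at key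
  omega

/-- Reduction of walks modulo `l`, keeping a node of `N`, when the paths have length at most `d`. -/
theorem Conn.reduce_of_path [DecidableEq V] [Fintype V]
    (hneg : ∀ v L w, HasWalk E a v v L w → w ≤ 0) {N : Finset V} {d : ℕ}
    (hd : ∀ (f : ℕ → V) (p : ℕ), (∀ s < p, E (f s) (f (s + 1))) →
      (∀ x ≤ p, ∀ y ≤ p, f x = f y → x = y) → p ≤ d)
    {l : ℕ} (hl : 1 ≤ l) {i j : V} {t : ℕ} {w : ℝ}
    (h : Conn E a N i j t w) (ht : Fintype.card V * l + d < t + 1) :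
    ∃ t' < t, t' ≡ t [MOD l] ∧ Conn E a N i j t' w := by
  by_contra hirr
  obtain ⟨p, q, f, g, rfl, f0, fp, -, -, fs, gs, hN, h2, h3, h4, h5⟩ :=
    h.exists_irreducible hneg hirr
  have e1 := Finset.card_eq_sum_card_fiberwise (f := f) (s := Finset.range p) (t := Finset.univ)
    (fun s _ => Finset.mem_univ _)
  have e2 := Finset.card_eq_sum_card_fiberwise (f := g) (s := Finset.range (q + 1))
    (t := Finset.univ) (fun s _ => Finset.mem_univ _)
  have h3' : ∀ x y, x < y → y < q + 1 → g x = g y → ¬ l ∣ y - x :=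
    fun x y hxy hy => h3 x y hxy (by omega)
  have bA := card_fiber_le (m := p) hl fun x y hxy hy => h2 x y hxy hy.le
  have bB := card_fiber_le (m := q + 1) hl h3'
  rw [Finset.card_range] at e1 e2
  have hab : ∀ v, 1 < ((Finset.range p).filter fun s => f s = v).card →
      ((Finset.range (q + 1)).filter fun s => g s = v).card = 0 := by
    intro v h1
    obtain ⟨x, hx, y, hy, hxy⟩ := Finset.one_lt_card.1 h1
    simp only [Finset.mem_filter, Finset.mem_range] at hx hy
    have : ∀ s ≤ q, g s ≠ v := by
      intro s hs
      rcases lt_or_gt_of_ne hxy with hlt | hlt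
      · exact hx.2 ▸ h4 x y s hlt hy.1.le hs (hx.2.trans hy.2.symm)
      · exact hy.2 ▸ h4 y x s hlt hx.1.le hs (hy.2.trans hx.2.symm)
    rw [Finset.filter_false_of_mem (s := Finset.range (q + 1)), Finset.card_empty]
    intro s hs
    exact this s (Nat.lt_succ_iff.1 (Finset.mem_range.1 hs))
  -- If the second part visits some node `l` times, its loops there realize every nonzero residue
  -- modulo `l`. A loop of the first part could then be removed together with a complementary one,
  -- so the first part is a path and `p ≤ d`.
  by_cases hc : ∃ v, 1 ≤ ((Finset.range p).filter fun s => f s = v).card ∧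
      l ≤ ((Finset.range (q + 1)).filter fun s => g s = v).card
  · obtain ⟨v, -, hvl⟩ := hc
    have hpath : ∀ x y, x < y → y ≤ p → f x ≠ f y := by
      intro x y hxy hy he
      obtain ⟨x', y', hxy', hy', hx'v, hy'v, hdvd⟩ :=
        exists_loop_of_card_fiber_eq hl h3' v hvl (h2 x y hxy hy he)
      exact h5 x y x' y' hxy hy hxy' (by omega) he (hx'v.trans hy'v.symm) hdvd
    have hpd : p ≤ d := by
      refine hd f p fs fun x hx y hy he => ?_
      by_contra hne
      rcases lt_or_gt_of_ne hne with hlt | hlt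
      · exact hpath x y hlt hy he
      · exact hpath y x hlt hx he.symm
    have key : ∑ v, (((Finset.range p).filter fun s => f s = v).card +
        ((Finset.range (q + 1)).filter fun s => g s = v).card) ≤
        ∑ v, (l + ((Finset.range p).filter fun s => f s = v).card) := by
      refine Finset.sum_le_sum fun v _ => ?_
      have := bB v
      omega
    rw [Finset.sum_add_distrib, Finset.sum_add_distrib, ← e1, ← e2, Finset.sum_const,
      Finset.card_univ, smul_eq_mul] at key
    omega
  -- Now every node has at most `l` visits in total: one visit in the first part leaves fewer than
  -- `l` for the second, and two or more leave none.
  · push Not at hc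
    have key : ∑ v, (((Finset.range p).filter fun s => f s = v).card +
        ((Finset.range (q + 1)).filter fun s => g s = v).card) ≤ ∑ _v : V, l := by
      refine Finset.sum_le_sum fun v _ => ?_
      have h1 := hc v
      have h2 := hab v
      have h3 := bA v
      have h4 := bB v
      omega
    rw [Finset.sum_add_distrib, ← e1, ← e2, Finset.sum_const, Finset.card_univ, smul_eq_mul] at key
    omega

/-- A list of at least `|G|` elements of a finite abelian group `G` has a nonempty sublist of sum
zero. -/
theorem exists_sublist_sum_eq_zero {G : Type*} [AddCommGroup G] [Fintype G] (L : List G)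
    (hL : Fintype.card G ≤ L.length) : ∃ L', L'.Sublist L ∧ L' ≠ [] ∧ L'.sum = 0 := by
  -- Two of the `|G| + 1` indexed prefix sums coincide; the block between them has sum zero.
  obtain ⟨x, y, hne, hxy⟩ := Fintype.exists_ne_map_eq_of_card_lt
    (fun x : Fin (L.length + 1) => (L.take x).sum) (by simpa using Nat.lt_succ_of_le hL)
  wlog hlt : x < y generalizing x y
  · exact this y x hne.symm hxy.symm (lt_of_le_of_ne (not_lt.1 hlt) hne.symm)
  have hsub : (x : ℕ) ≤ y := Fin.le_def.1 hlt.le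
  refine ⟨(L.take y).drop x, (List.drop_sublist _ _).trans (List.take_sublist _ _), ?_, ?_⟩
  · rw [← List.length_pos_iff]
    have := y.2
    have := Fin.lt_def.1 hlt
    simp only [List.length_drop, List.length_take]
    omega
  · have h1 := List.sum_take_add_sum_drop (L.take y) x
    rw [List.take_take, min_eq_left hsub] at h1
    rw [show (L.take x).sum = (L.take y).sum from hxy] at h1
    simpa using h1

/-- A walk of length at least `m * (d + 1)` contains `m` disjoint loops that can be removed
independently. -/
theorem HasWalk.exists_loops (hneg : ∀ v L w, HasWalk E a v v L w → w ≤ 0) {d : ℕ}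
    (hd : ∀ (f : ℕ → V) (p : ℕ), (∀ s < p, E (f s) (f (s + 1))) →
      (∀ x ≤ p, ∀ y ≤ p, f x = f y → x = y) → p ≤ d) (m : ℕ) {i j : V} {L : ℕ} {w : ℝ}
    (h : HasWalk E a i j L w) (hL : m * (d + 1) ≤ L) :
    ∃ K : List ℕ, K.length = m ∧ (∀ r ∈ K, 0 < r) ∧ K.sum ≤ L ∧
      ∀ K' : List ℕ, K'.Sublist K → ∃ w', w ≤ w' ∧ HasWalk E a i j (L - K'.sum) w' := by
  induction m generalizing i L w with
  | zero =>
    refine ⟨[], rfl, by simp, by simp, fun K' hK' => ?_⟩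
    rw [List.sublist_nil.1 hK']
    exact ⟨w, le_rfl, h⟩
  | succ m ih =>
    obtain ⟨f, f0, fL, fs, rfl⟩ := h.exists_fun
    have hdL : d + 1 ≤ L := by nlinarith
    -- The first `d + 1` steps are too many for a path. Taking one loop from each block of `d + 1`
    -- steps keeps the loops disjoint.
    have hloop : ∃ x y, x < y ∧ y ≤ d + 1 ∧ f x = f y := by
      by_contra hcon
      push Not at hcon
      have := hd f (d + 1) (fun s hs => fs s (by omega)) fun x hx y hy he => by
        by_contra hne
        rcases lt_or_gt_of_ne hne with hlt | hlt
        · exact hcon x y hlt hy he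
        · exact hcon y x hlt hx he.symm
      omega
    obtain ⟨x, y, hxy, hy, he⟩ := hloop
    have h1 : HasWalk E a (f 0) (f (d + 1)) (d + 1 - 0) _ :=
      HasWalk.ofFun (Nat.zero_le _) fun s _ hs => fs s (by omega)
    have h2 : HasWalk E a (f (d + 1)) (f L) (L - (d + 1)) _ :=
      HasWalk.ofFun hdL fun s _ hs => fs s (by omega)
    obtain ⟨w1, hw1, H1⟩ := HasWalk.remove_loop hneg (fun s hs => fs s (by omega)) hxy.le hy he
    rw [fL] at h2
    rw [f0] at h1 H1
    obtain ⟨K, hKm, hK0, hKs, hK⟩ := ih h2 (by rw [Nat.succ_mul] at hL; omega)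
    rw [← Finset.sum_Ico_consecutive _ (Nat.zero_le _) hdL]
    refine ⟨(y - x) :: K, by simp [hKm], ?_, by simp only [List.sum_cons]; omega, ?_⟩
    · intro r hr
      rcases List.mem_cons.1 hr with rfl | hr
      · omega
      · exact hK0 r hr
    · intro K' hK'
      rcases List.sublist_cons_iff.1 hK' with hs | ⟨K'', rfl, hs⟩
      · obtain ⟨w', hw', H⟩ := hK K' hs
        have := hs.sum_le_sum fun _ _ => Nat.zero_le _
        exact ⟨_, add_le_add le_rfl hw', (h1.trans H).cast (by omega) rfl⟩
      · obtain ⟨w', hw', H⟩ := hK K'' hs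
        have := hs.sum_le_sum fun _ _ => Nat.zero_le _
        exact ⟨_, add_le_add hw1 hw', (H1.trans H).cast (by simp only [List.sum_cons]; omega) rfl⟩

/-- Reduction of walks modulo `l` by the removal of disjoint loops, keeping a node of `N`. -/
theorem Conn.reduce_of_loops (hneg : ∀ v L w, HasWalk E a v v L w → w ≤ 0) {N : Finset V} {d : ℕ}
    (hd : ∀ (f : ℕ → V) (p : ℕ), (∀ s < p, E (f s) (f (s + 1))) →
      (∀ x ≤ p, ∀ y ≤ p, f x = f y → x = y) → p ≤ d)
    {l : ℕ} (hl : 1 ≤ l) {i j : V} {t : ℕ} {w : ℝ}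
    (h : Conn E a N i j t w) (ht : (l - 1) * (d + 1) + 2 * d < t) :
    ∃ t' < t, t' ≡ t [MOD l] ∧ Conn E a N i j t' w := by
  obtain ⟨k, hk, p, q, u, v, hu, hv, rfl, hw⟩ := h
  obtain ⟨K1, hm1, hp1, hs1, H1⟩ := hu.exists_loops hneg hd (p / (d + 1)) (Nat.div_mul_le_self _ _)
  obtain ⟨K2, hm2, hp2, hs2, H2⟩ := hv.exists_loops hneg hd (q / (d + 1)) (Nat.div_mul_le_self _ _)
  have : NeZero l := ⟨by omega⟩
  -- Each part wastes at most `d` steps after its last full block, which explains `2 * d` in the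
  -- bound.
  have hlen : l ≤ K1.length + K2.length := by
    rw [hm1, hm2]
    by_contra hcon
    have h1 := Nat.lt_div_mul_add (a := p) (Nat.succ_pos d)
    have h2 := Nat.lt_div_mul_add (a := q) (Nat.succ_pos d)
    have h3 : p / (d + 1) + q / (d + 1) ≤ l - 1 := by omega
    have h4 := Nat.mul_le_mul_right (d + 1) h3
    rw [add_mul] at h4
    simp only [Nat.succ_eq_add_one] at h1 h2
    omega
  obtain ⟨K', hK', hne, hsum⟩ := exists_sublist_sum_eq_zero
    ((K1 ++ K2).map (fun r : ℕ => (r : ZMod l))) (by simpa [ZMod.card] using hlen)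
  obtain ⟨K, hK, rfl⟩ := List.sublist_map_iff.1 hK'
  obtain ⟨L1, L2, rfl, hL1, hL2⟩ := List.sublist_append_iff.1 hK
  have hdvd : l ∣ L1.sum + L2.sum := by
    rw [← ZMod.natCast_eq_zero_iff, ← hsum]
    simp [Nat.cast_list_sum]
  have hpos : 0 < L1.sum + L2.sum := by
    rw [← List.sum_append]
    refine List.sum_pos _ (fun r hr => ?_) (by simpa using hne)
    rcases List.mem_append.1 hr with hr | hr
    · exact hp1 r (hL1.subset hr)
    · exact hp2 r (hL2.subset hr)
  obtain ⟨u', hu', hu1⟩ := H1 L1 hL1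
  obtain ⟨v', hv', hv1⟩ := H2 L2 hL2
  have b1 := hL1.sum_le_sum fun _ _ => Nat.zero_le _
  have b2 := hL2.sum_le_sum fun _ _ => Nat.zero_le _
  refine ⟨p - L1.sum + (q - L2.sum), by omega, ?_, k, hk, _, _, _, _, hu1, hv1, rfl, by linarith⟩
  refine (Nat.modEq_iff_dvd' (by omega)).2 ?_
  rwa [show p + q - (p - L1.sum + (q - L2.sum)) = L1.sum + L2.sum by omega]

end Reduction

/-! ### Zero-sum free sequences and the Hamiltonian case -/

section Hamiltonian

variable {n : ℕ}

/-- A list over `ZMod n` is zero-sum free if no nonempty sublist has sum zero. -/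
def ZeroSumFree (L : List (ZMod n)) : Prop := ∀ K : List (ZMod n), K.Sublist L → K ≠ [] → K.sum ≠ 0

theorem ZeroSumFree.perm {L L' : List (ZMod n)} (h : ZeroSumFree L) (hp : L'.Perm L) :
    ZeroSumFree L' := by
  intro K hK hne
  obtain ⟨K', hp', hs⟩ := (hK.subperm.trans hp.subperm : K.Subperm L)
  rw [← hp'.sum_eq]
  refine h K' hs fun h0 => hne ?_
  rw [h0] at hp'
  exact List.nil_perm.1 hp'

theorem ZeroSumFree.length_lt [NeZero n] {L : List (ZMod n)} (h : ZeroSumFree L) :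
    L.length < n := by
  by_contra hcon
  obtain ⟨K, hK, hne, h0⟩ := exists_sublist_sum_eq_zero L (by rw [ZMod.card]; omega)
  exact h K hK hne h0

/-- A zero-sum free list of maximal length in `ZMod n` is constant. -/
theorem ZeroSumFree.eq_of_mem [NeZero n] {L : List (ZMod n)} (h : ZeroSumFree L)
    (hn : L.length + 1 = n) {x y : ZMod n} (hx : x ∈ L) (hy : y ∈ L) : x = y := by
  by_contra hne
  have hy' : y ∈ L.erase x := (List.mem_erase_of_ne (Ne.symm hne)).2 hy
  have hp : (x :: y :: (L.erase x).erase y).Perm L :=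
    (((List.perm_cons_erase hy').symm).cons x).trans (List.perm_cons_erase hx).symm
  generalize (L.erase x).erase y = R at hp
  have hz := h.perm hp
  have hlen := hp.length_eq
  -- The `n` prefix sums of a list starting with `x, y`, together with the extra value `y`, cannot
  -- all differ in `ZMod n`. Any coincidence gives a nonempty zero-sum sublist or `x = y`.
  obtain ⟨u, v, huv, he⟩ := Fintype.exists_ne_map_eq_of_card_lt
    (fun k : Option (Fin n) => (k.elim y fun k => ((x :: y :: R).take k).sum : ZMod n))
    (by simp [ZMod.card])
  have haux : ∀ k : Fin n, y ≠ ((x :: y :: R).take k).sum := by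
    rintro ⟨_ | _ | k, hk⟩ he
    · exact hz [y] (((List.nil_sublist R).cons_cons y).cons x) (by simp)
        (by simpa using he)
    · exact hne (by simpa using he.symm)
    · refine hz (x :: R.take k) ?_ (by simp) ?_
      · exact ((List.take_sublist k R).cons y).cons_cons x
      · simp only [List.take_succ_cons, List.sum_cons] at he ⊢
        have : y + (x + (R.take k).sum) = y + 0 := by rw [add_zero]; nth_rewrite 2 [he]; ring
        exact add_left_cancel this
  have haux2 : ∀ k k' : Fin n, k < k' →
      ((x :: y :: R).take k).sum ≠ ((x :: y :: R).take k').sum := by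
    intro k k' hlt he
    refine hz (((x :: y :: R).take k').drop k)
      ((List.drop_sublist _ _).trans (List.take_sublist _ _)) ?_ ?_
    · rw [← List.length_pos_iff]
      have := k'.2
      have := Fin.lt_def.1 hlt
      simp only [List.length_drop, List.length_take]
      omega
    · have h1 := List.sum_take_add_sum_drop ((x :: y :: R).take k') k
      rw [List.take_take, min_eq_left (Fin.le_def.1 hlt.le), he] at h1
      exact left_eq_add.1 h1.symm
  cases u with
  | none =>
    cases v with
    | none => exact huv rfl
    | some v => exact haux v he
  | some u =>
    cases v with
    | none => exact haux u he.symm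
    | some v =>
      have huv' : u ≠ v := fun h => huv (h ▸ rfl)
      rcases lt_or_gt_of_ne huv' with hlt | hlt
      · exact haux2 u v hlt he
      · exact haux2 v u hlt he.symm

variable {E : ZMod n → ZMod n → Prop} {b : ZMod n → ZMod n → ℝ}

/-- The length of the walk from `i` to `j` that uses the edges of a list in this order, and that
follows the Hamiltonian cycle `x ↦ x + 1` in between. -/
def jumpLength (j : ZMod n) : ZMod n → List (ZMod n × ZMod n) → ℕ
  | i, [] => (j - i).val
  | i, e :: J => (e.1 - i).val + 1 + jumpLength j e.2 J

/-- The deviation of an edge from the edge of the Hamiltonian cycle with the same source. -/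
def jumpShift (e : ZMod n × ZMod n) : ZMod n := e.2 - e.1 - 1

/-- The stretches along the cycle telescope. Hence, modulo `n`, the order of the jumps is irrelevant
and zero-sum sublists can be dropped. -/
theorem cast_jumpLength [NeZero n] (i j : ZMod n) (J : List (ZMod n × ZMod n)) :
    (jumpLength j i J : ZMod n) = j - i - (J.map jumpShift).sum := by
  induction J generalizing i with
  | nil => simp [jumpLength]
  | cons e J ih =>
    simp only [jumpLength, Nat.cast_add, ih, ZMod.natCast_zmod_val, List.map_cons, List.sum_cons,
      jumpShift, Nat.cast_one]
    ring

theorem hasWalk_along [NeZero n] (hE : ∀ x, E x (x + 1)) (hb : ∀ x, b x (x + 1) = 0)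
    (u v : ZMod n) : HasWalk E b u v (v - u).val 0 := by
  have : ∀ m : ℕ, HasWalk E b u (u + m) m 0 := by
    intro m
    induction m with
    | zero => simpa using HasWalk.nil u
    | succ m ih =>
      have := ih.trans (HasWalk.single (hE _))
      rw [hb, add_zero] at this
      simpa [add_assoc] using this
  simpa using this (v - u).val

theorem hasWalk_jumpLength [NeZero n] (hE : ∀ x, E x (x + 1)) (hb : ∀ x, b x (x + 1) = 0)
    (i j : ZMod n) (J : List (ZMod n × ZMod n)) (hJ : ∀ e ∈ J, E e.1 e.2) :
    HasWalk E b i j (jumpLength j i J) (J.map fun e => b e.1 e.2).sum := by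
  induction J generalizing i with
  | nil => exact hasWalk_along hE hb i j
  | cons e J ih =>
    have h1 := ih e.2 fun e' he' => hJ e' (List.mem_cons_of_mem _ he')
    exact (((hasWalk_along hE hb i e.1).trans
      (HasWalk.single (hJ e List.mem_cons_self))).trans h1).cast rfl
      (by rw [List.map_cons, List.sum_cons, zero_add])

theorem jumpLength_le [NeZero n] (i j : ZMod n) (J : List (ZMod n × ZMod n)) :
    jumpLength j i J ≤ J.length + (J.length + 1) * (n - 1) := by
  induction J generalizing i with
  | nil =>
    have := ZMod.val_lt (j - i)
    simp only [jumpLength, List.length_nil]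
    omega
  | cons e J ih =>
    have := ZMod.val_lt (e.1 - i)
    have := ih e.2
    simp only [jumpLength, List.length_cons, add_mul, one_mul] at *
    omega

/-- A stretch of length `n - 1` between consecutive jumps `x`, `y` means `y.1 = x.2 - 1 = x.1 + s`,
which is excluded; inner stretches therefore cost at most `n - 2`, and only the final one may cost
`n - 1`. -/
theorem jumpLength_le_of_isChain [NeZero n] (hn : 2 ≤ n) (j s : ZMod n)
    (e : ZMod n × ZMod n) (J : List (ZMod n × ZMod n)) (hs : ∀ x ∈ e :: J, jumpShift x = s)
    (hc : (e :: J).IsChain fun x y => y.1 ≠ x.1 + s) :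
    jumpLength j e.2 J ≤ J.length + J.length * (n - 2) + (n - 1) := by
  induction J generalizing e with
  | nil =>
    have := ZMod.val_lt (j - e.2)
    simp only [jumpLength, List.length_nil]
    omega
  | cons e' J ih =>
    have h1 := ih e' (fun x hx => hs x (List.mem_cons_of_mem _ hx)) hc.tail
    have h2 := ZMod.val_lt (e'.1 - e.2)
    have h3 : (e'.1 - e.2).val ≠ n - 1 := by
      intro h
      have h4 : ((e'.1 - e.2).val : ZMod n) = ((n - 1 : ℕ) : ZMod n) := by rw [h]
      rw [ZMod.natCast_zmod_val, Nat.cast_sub (by omega), ZMod.natCast_self] at h4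
      refine (List.isChain_cons_cons.1 hc).1 ?_
      have h5 := hs e List.mem_cons_self
      rw [jumpShift] at h5
      rw [← h5]
      have h6 : e'.1 = e.2 + (e'.1 - e.2) := by ring
      rw [h6, h4]
      push_cast
      ring
    simp only [jumpLength, List.length_cons, add_mul, one_mul]
    omega

/-- All edges are listed as jumps; those of the cycle have shift zero and disappear when the list is
made zero-sum free. -/
theorem HasWalk.exists_jumps {i j : ZMod n} {L : ℕ} {w : ℝ} (h : HasWalk E b i j L w) :
    ∃ J : List (ZMod n × ZMod n), (∀ e ∈ J, E e.1 e.2) ∧ (J.map fun e => b e.1 e.2).sum = w ∧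
      (J.map jumpShift).sum = j - i - L := by
  induction h with
  | nil i => exact ⟨[], by simp, by simp, by simp⟩
  | @cons i j k L w e _ ih =>
    obtain ⟨J, h1, h2, h3⟩ := ih
    refine ⟨(i, j) :: J, ?_, by simp [h2], ?_⟩
    · intro x hx
      rcases List.mem_cons.1 hx with rfl | hx
      · exact e
      · exact h1 x hx
    · simp only [List.map_cons, List.sum_cons, h3, jumpShift]
      push_cast
      ring

/-- A constant zero-sum free list of maximal length consists of a unit. -/
theorem ZeroSumFree.exists_mul_eq_one [NeZero n] {s : ZMod n}
    (h : ZeroSumFree (List.replicate (n - 1) s)) : ∃ c, c * s = 1 := by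
  have hinj : Function.Injective fun x : ZMod n => x * s := by
    intro x y hxy
    by_contra hne
    have h0 : (x - y) * s = 0 := by simp only at hxy; rw [sub_mul, hxy, sub_self]
    have hpos : 0 < (x - y).val := Nat.pos_of_ne_zero fun h => hne (by
      rw [ZMod.val_eq_zero] at h
      exact sub_eq_zero.1 h)
    have hlt := ZMod.val_lt (x - y)
    refine h (List.replicate (x - y).val s) (List.replicate_sublist_replicate s |>.2 (by omega)) ?_ ?_
    · rw [← List.length_pos_iff]; simpa using hpos
    · rw [List.sum_replicate, nsmul_eq_mul, ZMod.natCast_zmod_val, h0]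
  exact (Finite.injective_iff_surjective.1 hinj) 1

/-- Edges of a common shift `s` can be ordered such that no source follows the previous one. -/
theorem exists_perm_isChain [NeZero n] {s c : ZMod n} (hc : c * s = 1)
    (J : List (ZMod n × ZMod n)) (hJ : J.length < n) :
    ∃ J' : List (ZMod n × ZMod n), J'.Perm J ∧ J'.IsChain fun x y => y.1 ≠ x.1 + s := by
  obtain ⟨m, hm⟩ : ∃ m : ZMod n, m ∉ (J.map Prod.fst).toFinset := by
    by_contra hcon
    push Not at hcon
    have h1 := List.toFinset_card_le (J.map Prod.fst)
    rw [Finset.eq_univ_iff_forall.2 hcon, Finset.card_univ, ZMod.card, List.length_map] at h1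
    omega
  -- This is the position of `u` on the orbit of translation by `s`, which starts at `m + s` and
  -- ends at `m`. It grows from `u` to `u + s` unless `u = m`, and `m` is no source; sorting by
  -- decreasing `κ` therefore works.
  let κ : ZMod n → ℕ := fun u => ((u - (m + s)) * c).val
  have hκ : ∀ u, u ≠ m → κ u < κ (u + s) := by
    intro u hu
    have h1 : (u + s - (m + s)) * c = (u - (m + s)) * c + 1 := by rw [← hc]; ring
    have h2 : (u - (m + s)) * c ≠ -1 := by
      intro h
      refine hu ?_
      have h3 : (u - (m + s)) * (c * s) = -1 * s := by rw [← mul_assoc, h]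
      rw [hc] at h3
      linear_combination h3
    change ((u - (m + s)) * c).val < ((u + s - (m + s)) * c).val
    rw [h1]
    generalize (u - (m + s)) * c = x at h2
    have h3 : x.val + 1 < n := by
      have := ZMod.val_lt x
      rcases Nat.lt_or_ge (x.val + 1) n with h | h
      · exact h
      · refine absurd ?_ h2
        have h4 : ((x.val + 1 : ℕ) : ZMod n) = (n : ℕ) := by congr 1; omega
        rw [Nat.cast_add, ZMod.natCast_zmod_val, ZMod.natCast_self, Nat.cast_one] at h4
        exact eq_neg_of_add_eq_zero_left h4
    have h4 : x + 1 = ((x.val + 1 : ℕ) : ZMod n) := by simp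
    rw [h4, ZMod.val_natCast_of_lt h3]
    omega
  have hp := List.perm_insertionSort (fun x y : ZMod n × ZMod n => κ y.1 ≤ κ x.1) J
  have : Std.Total (fun x y : ZMod n × ZMod n => κ y.1 ≤ κ x.1) := ⟨fun x y => le_total _ _⟩
  have : IsTrans _ (fun x y : ZMod n × ZMod n => κ y.1 ≤ κ x.1) := ⟨fun x y z h h' => h'.trans h⟩
  refine ⟨_, hp, List.Pairwise.isChain ?_⟩
  refine List.Pairwise.imp_of_mem ?_ (List.pairwise_insertionSort _ J)
  intro x y hx _ hle he
  have hx' : x.1 ≠ m := by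
    rintro rfl
    exact hm (List.mem_toFinset.2 (List.mem_map_of_mem (hp.subset hx)))
  have := hκ x.1 hx'
  rw [← he] at this
  omega

/-- With a Hamiltonian cycle of weight zero and no positive edges, walks can be shortened
modulo `n` to length at most `n ^ 2 - n + 1`. -/
theorem HasWalk.reduce_hamiltonian [NeZero n] (hn : 2 ≤ n) (hE : ∀ x, E x (x + 1))
    (hb : ∀ x, b x (x + 1) = 0) (hneg : ∀ x y, E x y → b x y ≤ 0) {i j : ZMod n} {L : ℕ} {w : ℝ}
    (h : HasWalk E b i j L w) :
    ∃ L' w', L' ≤ (n - 1) ^ 2 + n ∧ L' ≡ L [MOD n] ∧ w ≤ w' ∧ HasWalk E b i j L' w' := by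
  classical
  -- A shortest list of jumps with enough weight and the right total shift is zero-sum free, as
  -- jumps have nonpositive weight.
  have hex : ∃ m, ∃ J : List (ZMod n × ZMod n), J.length = m ∧ (∀ e ∈ J, E e.1 e.2) ∧
      w ≤ (J.map fun e => b e.1 e.2).sum ∧ (J.map jumpShift).sum = j - i - L := by
    obtain ⟨J, h1, h2, h3⟩ := h.exists_jumps
    exact ⟨_, J, rfl, h1, h2.ge, h3⟩
  have hmin := fun m => @Nat.find_min _ _ hex m
  obtain ⟨J, hlen, hJ, hw, hs⟩ := Nat.find_spec hex
  generalize Nat.find hex = m at *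
  have hfree : ZeroSumFree (J.map jumpShift) := by
    intro K' hK' hne h0
    obtain ⟨K, hK, rfl⟩ := List.sublist_map_iff.1 hK'
    obtain ⟨R, hR⟩ := hK.exists_perm_append
    have e1 := (hR.map fun e => b e.1 e.2).sum_eq
    have e2 := (hR.map jumpShift).sum_eq
    have e3 := hR.length_eq
    rw [List.map_append, List.sum_append] at e1 e2
    rw [List.length_append] at e3
    have hpos : 0 < K.length := List.length_pos_iff.2 (by simpa using hne)
    have hKneg : (K.map fun e => b e.1 e.2).sum ≤ 0 := by
      refine (List.sum_le_card_nsmul _ 0 fun x hx => ?_).trans_eq (smul_zero _)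
      obtain ⟨e, he, rfl⟩ := List.mem_map.1 hx
      exact hneg _ _ (hJ e (hK.subset he))
    refine hmin R.length (by omega) ⟨R, rfl, fun e he => hJ e (hR.symm.subset
      (List.mem_append_right _ he)), by linarith, ?_⟩
    rw [← hs, e2, h0, zero_add]
  have hlt := hfree.length_lt
  rw [List.length_map] at hlt
  have hmod : ∀ J' : List (ZMod n × ZMod n), J'.Perm J → jumpLength j i J' ≡ L [MOD n] := by
    intro J' hp
    rw [← ZMod.natCast_eq_natCast_iff, cast_jumpLength, (hp.map jumpShift).sum_eq, hs]
    ring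
  have hval : ∀ J' : List (ZMod n × ZMod n), J'.Perm J →
      HasWalk E b i j (jumpLength j i J') (J.map fun e => b e.1 e.2).sum := by
    intro J' hp
    exact (hasWalk_jumpLength hE hb i j J' fun e he => hJ e (hp.subset he)).cast rfl
      (hp.map _).sum_eq
  obtain ⟨k, rfl⟩ : ∃ k, n = k + 2 := ⟨n - 2, by omega⟩
  by_cases hl : J.length + 1 < k + 2
  · refine ⟨_, _, ?_, hmod J (List.Perm.refl _), hw, hval J (List.Perm.refl _)⟩
    refine (jumpLength_le i j J).trans ?_
    have : J.length ≤ k := by omega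
    have h2 : (J.length + 1) * (k + 2 - 1) ≤ (k + 1) * (k + 2 - 1) :=
      Nat.mul_le_mul_right _ (by omega)
    rw [show k + 2 - 1 = k + 1 by omega] at *
    rw [pow_two]
    omega
  -- The extremal case of `n - 1` jumps: all shifts equal one unit, and a good ordering saves one
  -- step on each of the `n - 2` inner stretches.
  · have hl' : (J.map jumpShift).length + 1 = k + 2 := by rw [List.length_map]; omega
    obtain ⟨e0, he0⟩ : ∃ e, e ∈ J := List.exists_mem_of_length_pos (by omega)
    have hall : ∀ e ∈ J, jumpShift e = jumpShift e0 := fun e he =>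
      hfree.eq_of_mem hl' (List.mem_map_of_mem he) (List.mem_map_of_mem he0)
    have hrep : J.map jumpShift = List.replicate (k + 2 - 1) (jumpShift e0) := by
      refine List.eq_replicate_iff.2 ⟨by omega, fun x hx => ?_⟩
      obtain ⟨e, he, rfl⟩ := List.mem_map.1 hx
      exact hall e he
    obtain ⟨c, hc⟩ := (hrep ▸ hfree).exists_mul_eq_one
    obtain ⟨J', hp, hch⟩ := exists_perm_isChain hc J (by omega)
    refine ⟨_, _, ?_, hmod J' hp, hw, hval J' hp⟩
    have hplen := hp.length_eq
    match J', hplen, hp, hch with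
    | [], h0, _, _ => simp at h0; omega
    | e :: R, h0, hp, hch =>
      have h1 := jumpLength_le_of_isChain hn j _ e R (fun x hx => hall x (hp.subset hx)) hch
      have h2 := ZMod.val_lt (e.1 - i)
      rw [List.length_cons] at h0
      have hR : R.length = k := by omega
      rw [hR] at h1
      simp only [jumpLength]
      rw [show k + 2 - 1 = k + 1 by omega, show k + 2 - 2 = k by omega] at *
      nlinarith

end Hamiltonian

/-! ### Reaching a prescribed length -/

section Large

variable {V : Type*} {E : V → V → Prop} {a : V → V → ℝ}

/-- Numbering the nodes along the cycle identifies them with `ZMod n`. With the partial sums of the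
cycle as potential, its edges get weight zero, and any edge is nonpositive because it closes up
along the cycle at no cost. -/
theorem HasWalk.reduce_of_hamiltonian_cycle [Fintype V] {n : ℕ} (hV : Fintype.card V = n)
    (hn : 2 ≤ n) (hneg : ∀ v L w, HasWalk E a v v L w → w ≤ 0) {z : ℕ → V}
    (hz : ∀ s < n, E (z s) (z (s + 1))) (hz0 : z n = z 0)
    (hinj : ∀ x < n, ∀ y < n, z x = z y → x = y)
    (hw : ∑ s ∈ Finset.Ico 0 n, a (z s) (z (s + 1)) = 0) {i j : V} {L : ℕ} {w : ℝ}
    (h : HasWalk E a i j L w) :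
    ∃ L' w', L' ≤ (n - 1) ^ 2 + n ∧ L' ≡ L [MOD n] ∧ w ≤ w' ∧ HasWalk E a i j L' w' := by
  have : NeZero n := ⟨by omega⟩
  have hbij : Function.Bijective fun x : ZMod n => z x.val := by
    rw [Fintype.bijective_iff_injective_and_card]
    refine ⟨fun x y hxy => ZMod.val_injective n (hinj _ (ZMod.val_lt x) _ (ZMod.val_lt y) hxy), ?_⟩
    rw [ZMod.card, hV]
  let e : ZMod n ≃ V := Equiv.ofBijective _ hbij
  have he : ∀ m ≤ n, e (m : ZMod n) = z m := by
    intro m hm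
    change z (ZMod.val (m : ZMod n)) = z m
    rcases hm.lt_or_eq with hlt | rfl
    · rw [ZMod.val_natCast_of_lt hlt]
    · rw [ZMod.natCast_self, ZMod.val_zero, hz0]
  let H : ZMod n → ℝ := fun x => ∑ s ∈ Finset.Ico 0 x.val, a (z s) (z (s + 1))
  have hH : ∀ m ≤ n, H (m : ZMod n) = ∑ s ∈ Finset.Ico 0 m, a (z s) (z (s + 1)) := by
    intro m hm
    change ∑ s ∈ Finset.Ico 0 (ZMod.val (m : ZMod n)), _ = _
    rcases hm.lt_or_eq with hlt | rfl
    · rw [ZMod.val_natCast_of_lt hlt]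
    · rw [ZMod.natCast_self, ZMod.val_zero, hw, Finset.Ico_self, Finset.sum_empty]
  let E' : ZMod n → ZMod n → Prop := fun x y => E (e x) (e y)
  let a' : ZMod n → ZMod n → ℝ := fun x y => a (e x) (e y)
  let b : ZMod n → ZMod n → ℝ := fun x y => a' x y + H x - H y - 0
  have hx1 : ∀ x : ZMod n, x = ((x.val : ℕ) : ZMod n) ∧ x + 1 = ((x.val + 1 : ℕ) : ZMod n) :=
    fun x => ⟨by simp, by simp⟩
  have hE' : ∀ x, E' x (x + 1) := by
    intro x
    have := ZMod.val_lt x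
    change E (e x) (e (x + 1))
    rw [(hx1 x).2, he _ (by omega)]
    nth_rewrite 1 [(hx1 x).1]
    rw [he _ (by omega)]
    exact hz _ (by omega)
  have hb : ∀ x, b x (x + 1) = 0 := by
    intro x
    have := ZMod.val_lt x
    have h1 : H (x + 1) = H x + a (e x) (e (x + 1)) := by
      rw [(hx1 x).2, hH _ (by omega), he _ (by omega), Finset.sum_Ico_succ_top (Nat.zero_le _)]
      rfl
    change a (e x) (e (x + 1)) + H x - H (x + 1) - 0 = 0
    rw [h1]; ring
  have hto : ∀ {x y L w}, HasWalk E' b x y L w → HasWalk E a (e x) (e y) L (w - H x + H y) := by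
    intro x y L w h
    have h1 : HasWalk E' a' x y L (w - H x + H y) :=
      (h.reweight (E' := E') (a' := a') (-H) 0 (fun _ _ h => h)
        (fun u v _ => by simp only [b, Pi.neg_apply]; ring)).cast rfl
        (by simp only [Pi.neg_apply]; ring)
    exact h1.comap e (fun _ _ h => h) (fun _ _ _ => rfl)
  have hnegb : ∀ x y, E' x y → b x y ≤ 0 := by
    intro x y hxy
    have h1 := hto ((HasWalk.single hxy).trans (hasWalk_along hE' hb y x))
    have := hneg _ _ _ h1
    linarith
  have h1 : HasWalk E' a' (e.symm i) (e.symm j) L w :=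
    h.comap e.symm (fun u v h => by simpa [E'] using h) (fun u v _ => by simp [a'])
  have h2 := h1.reweight (E' := E') (a' := b) H 0 (fun _ _ h => h) (fun _ _ _ => rfl)
  obtain ⟨L', w', hL', hmod, hw', h3⟩ := h2.reduce_hamiltonian hn hE' hb hnegb
  have h4 := hto h3
  rw [e.apply_symm_apply, e.apply_symm_apply] at h4
  exact ⟨L', _, hL', hmod, by linarith, h4⟩

theorem Conn.exists_le {N : Finset V} {l B : ℕ} {i j : V} {w : ℝ}
    (hred : ∀ t, B < t → Conn E a N i j t w → ∃ t' < t, t' ≡ t [MOD l] ∧ Conn E a N i j t' w)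
    (L : ℕ) (h : Conn E a N i j L w) : ∃ L' ≤ B, L' ≡ L [MOD l] ∧ Conn E a N i j L' w := by
  induction L using Nat.strong_induction_on with
  | _ L ih =>
    by_cases hL : L ≤ B
    · exact ⟨L, hL, rfl, h⟩
    · obtain ⟨t', ht', hmod, h'⟩ := hred L (not_le.1 hL) h
      obtain ⟨L', hL', hmod', h''⟩ := ih t' ht' h'
      exact ⟨L', hL', hmod'.trans hmod, h''⟩

/-- `N` is the node set of a closed walk of length `l` and of nonnegative weight. -/
def IsCircuit (E : V → V → Prop) (a : V → V → ℝ) (N : Finset V) (l : ℕ) : Prop :=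
  ∀ x ∈ N, ∀ y ∈ N, Conn E a {y} x x l 0

theorem IsCircuit.ofFun [DecidableEq V] {z : ℕ → V} {l : ℕ}
    (hz : ∀ s < l, E (z s) (z (s + 1))) (hz0 : z l = z 0)
    (hw : 0 ≤ ∑ s ∈ Finset.Ico 0 l, a (z s) (z (s + 1))) :
    IsCircuit E a ((Finset.range l).image z) l := by
  intro x hx y hy
  obtain ⟨r, hr, rfl⟩ := Finset.mem_image.1 hx
  obtain ⟨s, hs, rfl⟩ := Finset.mem_image.1 hy
  rw [Finset.mem_range] at hr hs
  have seg : ∀ u v, u ≤ v → v ≤ l → HasWalk E a (z u) (z v) (v - u) _ := fun u v huv hv =>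
    HasWalk.ofFun huv fun m _ h => hz m (by omega)
  have e1 := Finset.sum_Ico_consecutive (fun s => a (z s) (z (s + 1))) (Nat.zero_le r) hr.le
  have e2 := Finset.sum_Ico_consecutive (fun s => a (z s) (z (s + 1))) (Nat.zero_le s) hs.le
  rcases le_total r s with hrs | hrs
  · have h1 := seg r s hrs hs.le
    have h2 := seg s l hs.le le_rfl
    have h3 := seg 0 r (Nat.zero_le r) hr.le
    rw [hz0] at h2
    refine ⟨z s, Finset.mem_singleton_self _, _, _, _, _, h1, h2.trans h3, by omega, ?_⟩
    have e3 := Finset.sum_Ico_consecutive (fun s => a (z s) (z (s + 1))) hrs hs.le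
    linarith
  · have h1 := seg r l hr.le le_rfl
    have h2 := seg 0 s (Nat.zero_le s) hs.le
    have h3 := seg s r hrs hr.le
    rw [hz0] at h1
    refine ⟨z s, Finset.mem_singleton_self _, _, _, _, _, h1.trans h2, h3, by omega, ?_⟩
    have e3 := Finset.sum_Ico_consecutive (fun s => a (z s) (z (s + 1))) hrs hr.le
    linarith

theorem IsCircuit.exists_hasWalk {N : Finset V} {l : ℕ} (hN : IsCircuit E a N l) {x : V}
    (hx : x ∈ N) (m : ℕ) : ∃ w, 0 ≤ w ∧ HasWalk E a x x (m * l) w := by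
  obtain ⟨w, hw, h⟩ := (hN x hx x hx).hasWalk
  exact ⟨_, by positivity, h.iterate m⟩

theorem Conn.pad {N : Finset V} {l : ℕ} (hN : IsCircuit E a N l) {i j : V} {L t : ℕ} {w : ℝ}
    (h : Conn E a N i j L w) (hL : L ≤ t) (hmod : L ≡ t [MOD l]) :
    ∃ w', w ≤ w' ∧ HasWalk E a i j t w' := by
  obtain ⟨k, hk, p, q, u, v, h1, h2, rfl, h4⟩ := h
  obtain ⟨m, hm⟩ := (Nat.modEq_iff_dvd' hL).1 hmod
  obtain ⟨x, hx, h5⟩ := hN.exists_hasWalk hk m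
  exact ⟨_, by linarith, ((h1.trans h5).trans h2).cast (by rw [mul_comm m l]; omega) rfl⟩

/-- Since `L < t`, at least one full turn of the circuit is inserted, and this turn visits `y`. -/
theorem Conn.pad_visit {N : Finset V} {l : ℕ} (hN : IsCircuit E a N l) {i j : V} {L t : ℕ}
    {w : ℝ} (h : Conn E a N i j L w) (hL : L < t) (hmod : L ≡ t [MOD l]) {y : V} (hy : y ∈ N) :
    Conn E a {y} i j t w := by
  obtain ⟨k, hk, p, q, u, v, h1, h2, rfl, h4⟩ := h
  obtain ⟨m, hm⟩ := (Nat.modEq_iff_dvd' hL.le).1 hmod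
  obtain ⟨m, rfl⟩ : ∃ m', m = m' + 1 := Nat.exists_eq_succ_of_ne_zero (by rintro rfl; omega)
  obtain ⟨x, hx, h5⟩ := hN.exists_hasWalk hk m
  obtain ⟨y', hy', p', q', u', v', h6, h7, h8, h9⟩ := hN k hk y hy
  refine ⟨y', hy', _, _, _, _, h1.trans h6, (h7.trans h5).trans h2, ?_, by linarith⟩
  rw [mul_add, mul_one, mul_comm] at hm
  omega

/-- The lengths for which walks can be reduced modulo the length of any cycle, for a graph with
`n` nodes, cycles of length at most `c`, and paths of length at most `d`. -/
def IsLarge (n c d t : ℕ) : Prop :=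
  wielandt n ≤ t ∨ (n - 1) * c + n ≤ t ∨ n * c + d + 1 ≤ t ∨ (c - 1) * (d + 1) + 2 * d + 1 ≤ t

/-- A connection can be replaced with one of any sufficiently large length in the same residue class
modulo the length of a cycle of weight zero. -/
theorem Conn.exists_hasWalk_of_isLarge [Fintype V] [DecidableEq V] {n c d l : ℕ}
    (hV : Fintype.card V = n)
    (hneg : ∀ v L w, HasWalk E a v v L w → w ≤ 0)
    (hd : ∀ (f : ℕ → V) (p : ℕ), (∀ s < p, E (f s) (f (s + 1))) →
      (∀ x ≤ p, ∀ y ≤ p, f x = f y → x = y) → p ≤ d)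
    (hl : 1 ≤ l) (hlc : l ≤ c) {z : ℕ → V}
    (hz : ∀ s < l, E (z s) (z (s + 1))) (hz0 : z l = z 0)
    (hinj : ∀ x < l, ∀ y < l, z x = z y → x = y)
    (hw : ∑ s ∈ Finset.Ico 0 l, a (z s) (z (s + 1)) = 0) {i j : V} {t L : ℕ} {w : ℝ}
    (h : Conn E a ((Finset.range l).image z) i j L w) (hmod : L ≡ t [MOD l])
    (ht : IsLarge n c d t) : ∃ w', w ≤ w' ∧ HasWalk E a i j t w' := by
  have hN := IsCircuit.ofFun hz hz0 hw.ge
  have hcard : ((Finset.range l).image z).card = l := by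
    rw [Finset.card_image_of_injOn, Finset.card_range]
    intro x hx y hy
    simp only [Finset.coe_range, Set.mem_Iio] at hx hy
    exact hinj x hx y hy
  generalize hNdef : (Finset.range l).image z = N at *
  have hln : l ≤ n := by rw [← hcard, ← hV]; exact Finset.card_le_univ N
  have hconc : ∀ B, (∀ L' ≤ B, L' ≡ t [MOD l] → L' ≤ t) →
      (∀ t, B < t → Conn E a N i j t w → ∃ t' < t, t' ≡ t [MOD l] ∧ Conn E a N i j t' w) →
      ∃ w', w ≤ w' ∧ HasWalk E a i j t w' := by
    intro B hB hred
    obtain ⟨L', hL', hmod', h'⟩ := h.exists_le hred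
    exact h'.pad hN (hB L' hL' (hmod'.trans hmod)) (hmod'.trans hmod)
  -- Counting visits gives `l * l + (n - l) * (l + 1) = (n - 1) * l + n`.
  have hred1 : ∀ t, (n - 1) * l + (n - 1) < t → Conn E a N i j t w →
      ∃ t' < t, t' ≡ t [MOD l] ∧ Conn E a N i j t' w := by
    intro t ht h
    refine h.reduce_of_card hneg (M := Finset.univ) hl (Finset.mem_univ _)
      (fun _ _ _ => Finset.mem_univ _) ?_
    rw [Finset.univ_inter, ← Finset.compl_eq_univ_sdiff, Finset.card_compl, hcard, hV]
    obtain ⟨k, rfl⟩ := Nat.exists_eq_add_of_le hln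
    rw [show l + k - l = k by omega]
    have : (l + k - 1) * l + l = (l + k) * l := by
      rw [← Nat.succ_mul]; congr 1; omega
    nlinarith
  -- By congruence, a length below `t + l` is already at most `t`. The Wielandt bound needs this
  -- slack.
  have hle : ∀ B, B < t + l → ∀ L' ≤ B, L' ≡ t [MOD l] → L' ≤ t := by
    intro B hB L' hL' hm
    by_contra hcon
    have := Nat.le_of_dvd (by omega) ((Nat.modEq_iff_dvd' (by omega)).1 hm.symm)
    omega
  rcases ht with ht | ht | ht | ht
  · unfold wielandt at ht
    split_ifs at ht with hn1
    · subst hn1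
      exact hconc _ (hle _ (by omega)) hred1
    · obtain ⟨m, rfl⟩ : ∃ m, n = m + 2 := ⟨n - 2, by omega⟩
      rw [show m + 2 - 1 = m + 1 by omega] at *
      by_cases hln' : l = m + 2
      · subst hln'
        obtain ⟨w1, hw1, h1⟩ := h.hasWalk
        obtain ⟨L', w', hL', hmod', hw', h2⟩ :=
          h1.reduce_of_hamiltonian_cycle hV (by omega) hneg hz hz0 hinj hw
        have hNu : N = Finset.univ := by
          rw [← Finset.card_eq_iff_eq_univ, hcard, hV]
        have h3 : Conn E a N i j L' w' :=
          ⟨i, hNu ▸ Finset.mem_univ i, 0, L', 0, w', HasWalk.nil i, h2, by omega, by linarith⟩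
        obtain ⟨w2, hw2, h4⟩ := h3.pad hN (hle _ (by
          rw [show m + 2 - 1 = m + 1 by omega] at hL'; omega) _ le_rfl (hmod'.trans hmod))
          (hmod'.trans hmod)
        exact ⟨w2, by linarith, h4⟩
      · refine hconc _ (hle _ ?_) hred1
        have : l ≤ m + 1 := by omega
        nlinarith
  · refine hconc _ (hle _ ?_) hred1
    have := Nat.mul_le_mul_left (n - 1) hlc
    omega
  · refine hconc (n * l + d) (hle _ ?_) fun t ht h => h.reduce_of_path hneg hd hl
      (by rw [hV]; omega)
    have := Nat.mul_le_mul_left n hlc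
    omega
  · refine hconc ((l - 1) * (d + 1) + 2 * d) (hle _ ?_) fun t ht h =>
      h.reduce_of_loops hneg hd hl ht
    have := Nat.mul_le_mul_right (d + 1) (Nat.sub_le_sub_right hlc 1)
    omega

/-- A connection of large length on a proper subset `M` of the nodes can be reduced modulo the
length of a cycle, unless the cycle is Hamiltonian and `M` misses exactly one node. -/
theorem Conn.reduce_of_isLarge [Fintype V] [DecidableEq V] {n c d l : ℕ}
    (hV : Fintype.card V = n)
    (hneg : ∀ v L w, HasWalk E a v v L w → w ≤ 0)
    (hd : ∀ (f : ℕ → V) (p : ℕ), (∀ s < p, E (f s) (f (s + 1))) →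
      (∀ x ≤ p, ∀ y ≤ p, f x = f y → x = y) → p ≤ d)
    (hl : 1 ≤ l) (hlc : l ≤ c) {M N : Finset V} (hN : N.card = l) (hM : M.card + 1 ≤ n)
    {i j : V} (hi : i ∈ M) (hE : ∀ u v, E u v → v ∈ M) {t : ℕ} {w : ℝ}
    (h : Conn E a N i j t w) (ht : IsLarge n c d t) :
    (∃ t' < t, t' ≡ t [MOD l] ∧ Conn E a N i j t' w) ∨
      (N = Finset.univ ∧ M.card + 1 = n ∧ 2 * n ≤ t + 2) := by
  have hMpos : 0 < M.card := Finset.card_pos.2 ⟨i, hi⟩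
  have hln : l ≤ n := by rw [← hN, ← hV]; exact Finset.card_le_univ N
  have hsplit : (M ∩ N).card * l + (M \ N).card * (l + 1) = M.card * l + (M \ N).card := by
    rw [← Finset.card_inter_add_card_sdiff M N]; ring
  have hsd : (M \ N).card ≤ M.card := Finset.card_le_card Finset.sdiff_subset
  have hsd' : (M \ N).card + l ≤ n := by
    have h1 : (M \ N).card ≤ Nᶜ.card := Finset.card_le_card fun x hx =>
      Finset.mem_compl.2 (Finset.mem_sdiff.1 hx).2
    rw [Finset.card_compl, hV, hN] at h1
    omega
  rcases ht with ht | ht | ht | ht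
  · unfold wielandt at ht
    rw [if_neg (by omega)] at ht
    obtain ⟨m, rfl⟩ : ∃ m, n = m + 2 := ⟨n - 2, by omega⟩
    rw [show m + 2 - 1 = m + 1 by omega] at *
    -- Unlike in `Conn.exists_hasWalk_of_isLarge`, a strict reduction at length `t` itself is
    -- wanted. With `l = n` and `|M| = n - 1` the count asks for `(n - 1) * n ≤ t`, which may exceed
    -- the Wielandt number: this is the exceptional case.
    by_cases hln' : l = m + 2
    · by_cases hM' : M.card + 1 = m + 2
      · refine Or.inr ⟨?_, hM', by nlinarith⟩
        rw [← Finset.card_eq_iff_eq_univ, hN, hV, hln']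
      · refine Or.inl (h.reduce_of_card hneg hl hi hE ?_)
        rw [hsplit]
        have : M.card ≤ m := by omega
        have := Nat.mul_le_mul_right l this
        subst hln'
        nlinarith
    · refine Or.inl (h.reduce_of_card hneg hl hi hE ?_)
      rw [hsplit]
      have h1 : M.card ≤ m + 1 := by omega
      have h2 := Nat.mul_le_mul_right l h1
      have h3 : l ≤ m + 1 := by omega
      nlinarith
  · refine Or.inl (h.reduce_of_card hneg hl hi hE ?_)
    rw [hsplit]
    have h1 := Nat.mul_le_mul (show M.card ≤ n - 1 by omega) hlc
    omega
  · refine Or.inl (h.reduce_of_path hneg hd hl ?_)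
    have := Nat.mul_le_mul_left n hlc
    rw [hV]
    omega
  · refine Or.inl (h.reduce_of_loops hneg hd hl ?_)
    have := Nat.mul_le_mul_right (d + 1) (Nat.sub_le_sub_right hlc 1)
    omega

end Large

/-! ### Lists of nodes versus sequences; cycles and their means -/

section Lists

variable {n : ℕ}

/-- The list of the first `L + 1` values of a sequence of nodes. -/
def walkList (f : ℕ → Fin n) (L : ℕ) : List (Fin n) := (List.range (L + 1)).map f

theorem length_walkList (f : ℕ → Fin n) (L : ℕ) : (walkList f L).length = L + 1 := by
  simp [walkList]

theorem getElem_walkList (f : ℕ → Fin n) (L s : ℕ) (h : s < (walkList f L).length) :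
    (walkList f L)[s] = f s := by
  simp [walkList]

theorem exists_eq_walkList {W : List (Fin n)} (hW : W ≠ []) :
    ∃ f, W = walkList f (Digr.len W) := by
  have hpos := List.length_pos_iff.2 hW
  refine ⟨fun s => W.getD s (W.head hW), List.ext_getElem ?_ fun s h1 h2 => ?_⟩
  · rw [length_walkList, Digr.len]; omega
  · rw [getElem_walkList, List.getD_eq_getElem _ _ h1]

theorem walkList_ne_nil (f : ℕ → Fin n) (L : ℕ) : walkList f L ≠ [] := by
  rw [← List.length_pos_iff, length_walkList]; omega

theorem len_walkList (f : ℕ → Fin n) (L : ℕ) : Digr.len (walkList f L) = L := by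
  simp [Digr.len, length_walkList]

theorem isChain_walkList {R : Fin n → Fin n → Prop} {f : ℕ → Fin n} {L : ℕ} :
    (walkList f L).IsChain R ↔ ∀ s < L, R (f s) (f (s + 1)) := by
  rw [List.isChain_iff_getElem]
  simp only [getElem_walkList, length_walkList]
  exact ⟨fun h s hs => h s (by omega), fun h s hs => h s (by omega)⟩

theorem mem_walkList {f : ℕ → Fin n} {L : ℕ} {v : Fin n} :
    v ∈ walkList f L ↔ ∃ s ≤ L, f s = v := by
  simp [walkList]

theorem head?_walkList (f : ℕ → Fin n) (L : ℕ) : (walkList f L).head? = some (f 0) := by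
  simp [walkList, List.range_succ_eq_map]

theorem getLast?_walkList (f : ℕ → Fin n) (L : ℕ) : (walkList f L).getLast? = some (f L) := by
  simp [walkList, List.range_succ]

theorem pair_infix_walkList {f : ℕ → Fin n} {L : ℕ} {i j : Fin n} :
    [i, j] <:+: walkList f L ↔ ∃ s < L, f s = i ∧ f (s + 1) = j := by
  constructor
  · rintro ⟨l, r, h⟩
    have hlen := congrArg List.length h
    simp only [List.length_append, length_walkList, List.length_cons, List.length_nil] at hlen
    refine ⟨l.length, by omega, ?_, ?_⟩
    · rw [← getElem_walkList f L l.length (by rw [length_walkList]; omega)]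
      simp [← h]
    · rw [← getElem_walkList f L (l.length + 1) (by rw [length_walkList]; omega)]
      simp [← h]
  · rintro ⟨s, hs, rfl, rfl⟩
    refine ⟨(walkList f L).take s, (walkList f L).drop (s + 2), ?_⟩
    have h1 : (walkList f L).drop s = f s :: f (s + 1) :: (walkList f L).drop (s + 2) := by
      rw [List.drop_eq_getElem_cons (by rw [length_walkList]; omega),
        List.drop_eq_getElem_cons (by rw [length_walkList]; omega), getElem_walkList,
        getElem_walkList]
    rw [List.append_assoc, List.cons_append, List.cons_append, List.nil_append, ← h1,
      List.take_append_drop]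

theorem nodup_walkList {f : ℕ → Fin n} {L : ℕ} :
    (walkList f L).Nodup ↔ ∀ x ≤ L, ∀ y ≤ L, f x = f y → x = y := by
  rw [List.nodup_iff_injective_getElem]
  constructor
  · intro h x hx y hy hxy
    have := @h ⟨x, by rw [length_walkList]; omega⟩ ⟨y, by rw [length_walkList]; omega⟩
      (by simpa only [getElem_walkList] using hxy)
    simpa using this
  · rintro h ⟨x, hx⟩ ⟨y, hy⟩ hxy
    rw [length_walkList] at hx hy
    simp only [getElem_walkList] at hxy
    simpa using h x (by omega) y (by omega) hxy

theorem tail_walkList (f : ℕ → Fin n) (L : ℕ) :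
    (walkList f (L + 1)).tail = walkList (fun s => f (s + 1)) L := by
  simp [walkList, List.range_succ_eq_map (n := L + 1), Function.comp_def]

theorem walkList_succ (f : ℕ → Fin n) (L : ℕ) :
    walkList f (L + 1) = f 0 :: walkList (fun s => f (s + 1)) L := by
  simp [walkList, List.range_succ_eq_map (n := L + 1), Function.comp_def]

theorem tail_nodup_walkList {f : ℕ → Fin n} {L : ℕ} (hL : 1 ≤ L) (h0 : f L = f 0) :
    (walkList f L).tail.Nodup ↔ ∀ x < L, ∀ y < L, f x = f y → x = y := by
  obtain ⟨L, rfl⟩ : ∃ m, L = m + 1 := ⟨L - 1, by omega⟩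
  rw [tail_walkList, nodup_walkList]
  constructor
  · intro h
    have key : ∀ x < L + 1, ∀ y < L + 1, x < y → f x ≠ f y := by
      intro x hx y hy hxy he
      obtain ⟨y, rfl⟩ : ∃ m, y = m + 1 := ⟨y - 1, by omega⟩
      rcases Nat.eq_zero_or_pos x with rfl | hp
      · have := h L le_rfl y (by omega) (h0.trans he)
        omega
      · obtain ⟨x, rfl⟩ : ∃ m, x = m + 1 := ⟨x - 1, by omega⟩
        have := h x (by omega) y (by omega) he
        omega
    intro x hx y hy he
    rcases lt_trichotomy x y with hlt | he' | hlt
    · exact absurd he (key x hx y hy hlt)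
    · exact he'
    · exact absurd he.symm (key y hy x hx hlt)
  · intro h
    have key : ∀ x ≤ L, ∀ y ≤ L, x < y → f (x + 1) ≠ f (y + 1) := by
      intro x hx y hy hxy he
      rcases hy.lt_or_eq with hlt | rfl
      · have := h (x + 1) (by omega) (y + 1) (by omega) he
        omega
      · have := h (x + 1) (by omega) 0 (by omega) (he.trans h0)
        omega
    intro x hx y hy he
    rcases lt_trichotomy x y with hlt | he' | hlt
    · exact absurd he (key x hx y hy hlt)
    · exact he'
    · exact absurd he.symm (key y hy x hx hlt)

/-- The real weights of the edges of the digraph of a matrix. -/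
noncomputable def realWeight (A : Mat n) (i j : Fin n) : ℝ := (A i j).unbotD 0

theorem coe_realWeight {A : Mat n} {i j : Fin n} (h : (digraph A).edge i j) :
    (realWeight A i j : WithBot ℝ) = A i j := by
  change A i j ≠ ⊥ at h
  obtain ⟨x, hx⟩ := WithBot.ne_bot_iff_exists.1 h
  rw [realWeight, ← hx, WithBot.unbotD_coe]

theorem weight_walkList {A : Mat n} {f : ℕ → Fin n} {L : ℕ}
    (h : ∀ s < L, (digraph A).edge (f s) (f (s + 1))) :
    weight A (walkList f L) =
      ((∑ s ∈ Finset.Ico 0 L, realWeight A (f s) (f (s + 1)) : ℝ) : WithBot ℝ) := by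
  induction L generalizing f with
  | zero => simp [walkList, weight]
  | succ L ih =>
    have h1 := ih (f := fun s => f (s + 1)) fun s hs => h (s + 1) (by omega)
    have h2 : weight A (walkList f (L + 1)) =
        A (f 0) (f 1) + weight A (walkList (fun s => f (s + 1)) L) := by
      rw [walkList_succ]
      cases L with
      | zero => simp [walkList, weight]
      | succ L =>
        rw [walkList_succ]
        simp [weight]
    rw [h2, h1, ← coe_realWeight (h 0 (by omega)), ← WithBot.coe_add, ← Finset.range_eq_Ico,
      ← Finset.range_eq_Ico, Finset.sum_range_succ', add_comm]

theorem isWalk_walkList {G : Digr n} {f : ℕ → Fin n} {L : ℕ} :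
    G.IsWalk (walkList f L) ↔
      (∀ s ≤ L, f s ∈ G.nodes) ∧ ∀ s < L, G.edge (f s) (f (s + 1)) := by
  rw [Digr.IsWalk, isChain_walkList]
  simp only [walkList_ne_nil, mem_walkList, ne_eq, not_false_eq_true, true_and, forall_exists_index,
    and_imp]
  exact and_congr_left' ⟨fun h s hs => h _ s hs rfl, fun h v s hs hv => hv ▸ h s hs⟩

theorem isClosedWalk_walkList {G : Digr n} {f : ℕ → Fin n} {L : ℕ} :
    G.IsClosedWalk (walkList f L) ↔
      ((∀ s ≤ L, f s ∈ G.nodes) ∧ ∀ s < L, G.edge (f s) (f (s + 1))) ∧ f L = f 0 := by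
  rw [Digr.IsClosedWalk, isWalk_walkList, head?_walkList, getLast?_walkList, Option.some_inj,
    eq_comm (a := f 0)]

/-- A sequence that runs through a cycle of length `L`. -/
def IsCycleFun (E : Fin n → Fin n → Prop) (f : ℕ → Fin n) (L : ℕ) : Prop :=
  1 ≤ L ∧ f L = f 0 ∧ (∀ s < L, E (f s) (f (s + 1))) ∧ ∀ x < L, ∀ y < L, f x = f y → x = y

theorem isCycle_walkList {A : Mat n} {f : ℕ → Fin n} {L : ℕ} :
    (digraph A).IsCycle (walkList f L) ↔ IsCycleFun (digraph A).edge f L := by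
  rw [Digr.IsCycle, isClosedWalk_walkList, len_walkList, IsCycleFun]
  constructor
  · rintro ⟨⟨⟨-, h1⟩, h2⟩, h3, h4⟩
    exact ⟨h3, h2, h1, (tail_nodup_walkList h3 h2).1 h4⟩
  · rintro ⟨h3, h2, h1, h4⟩
    exact ⟨⟨⟨fun _ _ => Set.mem_univ _, h1⟩, h2⟩, h3, (tail_nodup_walkList h3 h2).2 h4⟩

theorem mean_walkList {A : Mat n} {f : ℕ → Fin n} {L : ℕ}
    (h : ∀ s < L, (digraph A).edge (f s) (f (s + 1))) :
    mean A (walkList f L) =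
      (((∑ s ∈ Finset.Ico 0 L, realWeight A (f s) (f (s + 1))) / L : ℝ) : WithBot ℝ) := by
  rw [mean, weight_walkList h, len_walkList, WithBot.map_coe]

theorem IsCycleFun.le {E : Fin n → Fin n → Prop} {f : ℕ → Fin n} {L : ℕ} (h : IsCycleFun E f L) :
    L ≤ n := by
  have := Finset.card_le_card_of_injOn (s := Finset.range L) (t := Finset.univ) f
    (fun _ _ => Finset.mem_coe.2 (Finset.mem_univ _)) (fun x hx y hy hxy =>
      h.2.2.2 x (Finset.mem_range.1 hx) y (Finset.mem_range.1 hy) hxy)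
  simpa using this

theorem exists_of_isCycle {A : Mat n} {Z : List (Fin n)} (hZ : (digraph A).IsCycle Z) :
    ∃ f, Z = walkList f (Digr.len Z) ∧ IsCycleFun (digraph A).edge f (Digr.len Z) := by
  obtain ⟨f, hf⟩ := exists_eq_walkList hZ.1.1.1
  refine ⟨f, hf, ?_⟩
  rw [hf] at hZ
  exact isCycle_walkList.1 hZ

theorem finite_isCycle (A : Mat n) : {Z | (digraph A).IsCycle Z}.Finite := by
  refine (List.finite_length_le (Fin n) (n + 1)).subset fun Z hZ => ?_
  obtain ⟨f, hf, h⟩ := exists_of_isCycle hZ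
  have := h.le
  change Z.length ≤ n + 1
  rw [hf, length_walkList]
  omega

theorem finite_cycleMeans (A : Mat n) :
    {m | ∃ Z, (digraph A).IsCycle Z ∧ mean A Z = m}.Finite :=
  ((finite_isCycle A).image (mean A)).subset fun _ ⟨Z, hZ, h⟩ => ⟨Z, hZ, h⟩

theorem IsCycleFun.le_circumference {A : Mat n} {f : ℕ → Fin n} {L : ℕ}
    (h : IsCycleFun (digraph A).edge f L) : L ≤ (digraph A).circumference := by
  refine le_csSup ⟨n, ?_⟩ ⟨walkList f L, isCycle_walkList.2 h, len_walkList f L⟩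
  rintro m ⟨Z, hZ, rfl⟩
  obtain ⟨g, -, hg⟩ := exists_of_isCycle hZ
  exact hg.le

theorem le_cabDiameter {A : Mat n} {f : ℕ → Fin n} {p : ℕ}
    (hf : ∀ s < p, (digraph A).edge (f s) (f (s + 1)))
    (hinj : ∀ x ≤ p, ∀ y ≤ p, f x = f y → x = y) : p ≤ (digraph A).cabDiameter := by
  refine le_csSup ⟨n, ?_⟩ ⟨walkList f p, ⟨isWalk_walkList.2 ⟨fun _ _ => Set.mem_univ _, hf⟩,
    nodup_walkList.2 hinj⟩, len_walkList f p⟩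
  rintro m ⟨P, hP, rfl⟩
  have := hP.2.length_le_card
  rw [Fintype.card_fin] at this
  rw [Digr.len]
  omega

theorem le_maxCycleMean {A : Mat n} {Z : List (Fin n)} (hZ : (digraph A).IsCycle Z) :
    mean A Z ≤ maxCycleMean A :=
  le_csSup (finite_cycleMeans A).bddAbove ⟨Z, hZ, rfl⟩

theorem mean_ne_bot {A : Mat n} {Z : List (Fin n)} (hZ : (digraph A).IsCycle Z) :
    mean A Z ≠ ⊥ := by
  obtain ⟨f, hf, h⟩ := exists_of_isCycle hZ
  rw [hf, mean_walkList h.2.2.1]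
  exact WithBot.coe_ne_bot

/-- After subtraction of the maximum cycle mean, no closed walk has positive weight. -/
theorem hasWalk_sub_nonpos {A : Mat n} {l : ℝ} (hl : maxCycleMean A = l) (v : Fin n) (L : ℕ)
    (w : ℝ) (h : HasWalk (digraph A).edge (fun i j => realWeight A i j - l) v v L w) : w ≤ 0 := by
  refine HasWalk.nonpos_of_simple (fun f L hL h0 hs hinj => ?_) v L w h
  have h1 := le_maxCycleMean (isCycle_walkList.2 ⟨hL, h0.symm, hs, hinj⟩)
  rw [mean_walkList hs, hl, WithBot.coe_le_coe, div_le_iff₀ (by exact_mod_cast hL)] at h1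
  rw [Finset.sum_sub_distrib]
  simp only [Finset.sum_const, Nat.card_Ico, tsub_zero, nsmul_eq_mul]
  linarith

end Lists

/-! ### Matrix powers as greatest weights of walks -/

section Powers

variable {n : ℕ}

/-- Entries are tested against real lower bounds only: `⊥` has none, and a lower bound for a product
or power amounts to a walk. -/
theorem coe_le_add_iff {x : ℝ} {a b : WithBot ℝ} :
    (x : WithBot ℝ) ≤ a + b ↔ ∃ u v : ℝ, (u : WithBot ℝ) ≤ a ∧ (v : WithBot ℝ) ≤ b ∧ x ≤ u + v := by
  constructor
  · intro h
    induction a with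
    | bot => simp at h
    | coe a =>
      induction b with
      | bot => simp at h
      | coe b => exact ⟨a, b, le_rfl, le_rfl, by exact_mod_cast h⟩
  · rintro ⟨u, v, hu, hv, h⟩
    exact (WithBot.coe_le_coe.2 h).trans (by rw [WithBot.coe_add]; exact add_le_add hu hv)

theorem coe_le_mul_iff {x : ℝ} {A B : Mat n} {i j : Fin n} :
    (x : WithBot ℝ) ≤ mul A B i j ↔
      ∃ k, ∃ u v : ℝ, (u : WithBot ℝ) ≤ A i k ∧ (v : WithBot ℝ) ≤ B k j ∧ x ≤ u + v := by
  rw [mul, Finset.le_sup_iff (WithBot.bot_lt_coe x)]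
  simp only [Finset.mem_univ, true_and, coe_le_add_iff]

theorem coe_le_one_iff {x : ℝ} {i j : Fin n} :
    (x : WithBot ℝ) ≤ one n i j ↔ i = j ∧ x ≤ 0 := by
  rw [one]
  split_ifs with h
  · rw [← WithBot.coe_zero, WithBot.coe_le_coe]; simp [h]
  · simp [h]

theorem le_of_forall_coe_le {a b : WithBot ℝ}
    (h : ∀ x : ℝ, (x : WithBot ℝ) ≤ a → (x : WithBot ℝ) ≤ b) : a ≤ b := by
  induction a with
  | bot => exact bot_le
  | coe a => exact h a le_rfl

theorem mul_mono {A A' B B' : Mat n} (hA : ∀ i j, A i j ≤ A' i j) (hB : ∀ i j, B i j ≤ B' i j)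
    (i j : Fin n) : mul A B i j ≤ mul A' B' i j :=
  Finset.sup_mono_fun fun k _ => add_le_add (hA i k) (hB k j)

theorem pow_mono {A B : Mat n} (h : ∀ i j, A i j ≤ B i j) (t : ℕ) (i j : Fin n) :
    pow A t i j ≤ pow B t i j := by
  induction t generalizing i j with
  | zero => exact le_rfl
  | succ t ih => exact mul_mono ih h i j

/-- The entries of a matrix power are the greatest weights of walks. -/
theorem coe_le_pow_iff {A : Mat n} {t : ℕ} {x : ℝ} {i j : Fin n} :
    (x : WithBot ℝ) ≤ pow A t i j ↔
      ∃ w, x ≤ w ∧ HasWalk (digraph A).edge (realWeight A) i j t w := by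
  induction t generalizing x j with
  | zero =>
    rw [pow, coe_le_one_iff]
    constructor
    · rintro ⟨rfl, h⟩
      exact ⟨0, h, HasWalk.nil i⟩
    · rintro ⟨w, hw, h⟩
      cases h
      exact ⟨rfl, hw⟩
  | succ t ih =>
    rw [pow, coe_le_mul_iff]
    constructor
    · rintro ⟨k, u, v, hu, hv, h⟩
      obtain ⟨w, hw, h1⟩ := ih.1 hu
      have he : (digraph A).edge k j := by
        intro h0
        rw [h0] at hv
        simp at hv
      rw [← coe_realWeight he, WithBot.coe_le_coe] at hv
      exact ⟨_, by linarith, h1.trans (HasWalk.single he)⟩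
    · rintro ⟨w, hw, h⟩
      obtain ⟨f, rfl, rfl, hs, rfl⟩ := h.exists_fun
      have h1 : HasWalk (digraph A).edge (realWeight A) (f 0) (f t) (t - 0) _ :=
        HasWalk.ofFun (Nat.zero_le t) fun s _ h => hs s (by omega)
      refine ⟨f t, _, realWeight A (f t) (f (t + 1)), ih.2 ⟨_, le_rfl, h1⟩,
        (coe_realWeight (hs t (by omega))).le, ?_⟩
      rwa [Finset.sum_Ico_succ_top (Nat.zero_le t)] at hw

theorem coe_le_pow_pow_iff {A : Mat n} {g m : ℕ} {x : ℝ} {i j : Fin n} :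
    (x : WithBot ℝ) ≤ pow (pow A g) m i j ↔ (x : WithBot ℝ) ≤ pow A (m * g) i j := by
  induction m generalizing x j with
  | zero => rw [pow, zero_mul, pow]
  | succ m ih =>
    rw [pow, coe_le_mul_iff, coe_le_pow_iff]
    constructor
    · rintro ⟨k, u, v, hu, hv, h⟩
      obtain ⟨w, hw, h1⟩ := coe_le_pow_iff.1 (ih.1 hu)
      obtain ⟨w', hw', h2⟩ := coe_le_pow_iff.1 hv
      exact ⟨_, by linarith, (h1.trans h2).cast (by ring) rfl⟩
    · rintro ⟨w, hw, h⟩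
      obtain ⟨f, rfl, rfl, hs, rfl⟩ := h.exists_fun
      have hle : m * g ≤ (m + 1) * g := Nat.mul_le_mul_right g (Nat.le_succ m)
      have h1 : HasWalk (digraph A).edge (realWeight A) (f 0) (f (m * g)) (m * g - 0) _ :=
        HasWalk.ofFun (Nat.zero_le _) fun s _ h => hs s (by omega)
      have h2 : HasWalk (digraph A).edge (realWeight A) (f (m * g)) (f ((m + 1) * g))
          ((m + 1) * g - m * g) _ :=
        HasWalk.ofFun hle fun s _ h => hs s (by omega)
      refine ⟨f (m * g), _, _, ih.2 (coe_le_pow_iff.2 ⟨_, le_rfl, h1⟩),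
        coe_le_pow_iff.2 ⟨_, le_rfl, h2.cast (by rw [Nat.succ_mul]; omega) rfl⟩, ?_⟩
      rwa [Finset.sum_Ico_consecutive _ (Nat.zero_le _) hle]

end Powers

/-! ### Subtracting the maximum cycle mean; the Kleene star -/

section Normalized

variable {n : ℕ} {A : Mat n} {l : ℝ}

/-- The edge weights after subtraction of the scalar `l`. -/
noncomputable def subWeight (A : Mat n) (l : ℝ) (i j : Fin n) : ℝ := realWeight A i j - l

theorem coe_subWeight (hl : maxCycleMean A = l) {i j : Fin n} (h : (digraph A).edge i j) :
    (subWeight A l i j : WithBot ℝ) = inv (maxCycleMean A) + A i j := by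
  rw [hl, inv, WithBot.map_coe, ← coe_realWeight h, ← WithBot.coe_add, subWeight]
  congr 1
  ring

theorem edge_smul_inv (hl : maxCycleMean A = l) {i j : Fin n} :
    (digraph (smul (inv (maxCycleMean A)) A)).edge i j ↔ (digraph A).edge i j := by
  change inv (maxCycleMean A) + A i j ≠ ⊥ ↔ A i j ≠ ⊥
  rw [hl, inv, WithBot.map_coe, Ne, WithBot.add_eq_bot]
  simp

theorem realWeight_smul_inv (hl : maxCycleMean A = l) {i j : Fin n}
    (h : (digraph A).edge i j) :
    realWeight (smul (inv (maxCycleMean A)) A) i j = subWeight A l i j := by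
  rw [realWeight, smul, ← coe_subWeight hl h, WithBot.unbotD_coe]

theorem coe_le_pow_smul_inv (hl : maxCycleMean A = l) {t : ℕ} {x : ℝ} {i j : Fin n} :
    (x : WithBot ℝ) ≤ pow (smul (inv (maxCycleMean A)) A) t i j ↔
      ∃ w, x ≤ w ∧ HasWalk (digraph A).edge (subWeight A l) i j t w := by
  rw [coe_le_pow_iff]
  refine exists_congr fun w => and_congr_right fun _ => ⟨fun h => ?_, fun h => ?_⟩
  · exact h.comap id (fun _ _ => (edge_smul_inv hl).1) fun u v h =>
      (realWeight_smul_inv hl ((edge_smul_inv hl).1 h)).symm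
  · exact h.comap id (fun _ _ => (edge_smul_inv hl).2) fun u v h => realWeight_smul_inv hl h

theorem subWeight_nonpos (hl : maxCycleMean A = l) (v : Fin n) (L : ℕ) (w : ℝ)
    (h : HasWalk (digraph A).edge (subWeight A l) v v L w) : w ≤ 0 :=
  hasWalk_sub_nonpos hl v L w h

theorem HasWalk.le_length_mul {V : Type*} {E : V → V → Prop} {a : V → V → ℝ} {K : ℝ}
    (hK : ∀ u v, a u v ≤ K) {i j : V} {L : ℕ} {w : ℝ} (h : HasWalk E a i j L w) : w ≤ L * K := by
  induction h with
  | nil i => simp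
  | @cons i j _ _ _ _ _ ih => have := hK i j; push_cast; linarith

/-- If no closed walk has positive weight, then the weights of walks are bounded above. -/
theorem exists_walk_bound {E : Fin n → Fin n → Prop} {a : Fin n → Fin n → ℝ}
    (hneg : ∀ v L w, HasWalk E a v v L w → w ≤ 0) :
    ∃ K, ∀ i j L w, HasWalk E a i j L w → w ≤ K := by
  have hK : ∀ u v, a u v ≤ ∑ p : Fin n × Fin n, |a p.1 p.2| := fun u v =>
    (le_abs_self _).trans (Finset.single_le_sum (f := fun p : Fin n × Fin n => |a p.1 p.2|)
      (fun _ _ => abs_nonneg _) (Finset.mem_univ (u, v)))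
  have hK0 : 0 ≤ ∑ p : Fin n × Fin n, |a p.1 p.2| := Finset.sum_nonneg fun _ _ => abs_nonneg _
  refine ⟨n * ∑ p : Fin n × Fin n, |a p.1 p.2|, fun i j L w h => ?_⟩
  have hc : Conn E a Finset.univ i j L w :=
    ⟨i, Finset.mem_univ i, 0, L, 0, w, HasWalk.nil i, h, by omega, by linarith⟩
  -- Modulo 1 every loop is removable, so at most `n` steps matter.
  obtain ⟨L', hL', -, h'⟩ := hc.exists_le (l := 1) (B := n) fun t ht h =>
    h.reduce_of_card hneg le_rfl (Finset.mem_univ i) (fun _ _ _ => Finset.mem_univ _)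
      (by simp; omega)
  obtain ⟨w', hw', h''⟩ := h'.hasWalk
  refine (hw'.trans (h''.le_length_mul hK)).trans ?_
  exact mul_le_mul_of_nonneg_right (by exact_mod_cast hL') hK0

/-- The supremum in `star` dominates its terms only if they are bounded above, which holds since no
closed walk is positive. -/
theorem coe_le_csrM (hl : maxCycleMean A = l) {G : Digr n} {m : ℕ} {i j : Fin n} {w : ℝ}
    (h : HasWalk (digraph A).edge (subWeight A l) i j (m * G.cyclicity) w) :
    (w : WithBot ℝ) ≤ csrM A G i j := by
  obtain ⟨K, hK⟩ := exists_walk_bound (subWeight_nonpos hl)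
  have hb : BddAbove (Set.range fun k : ℕ =>
      pow (pow (smul (inv (maxCycleMean A)) A) G.cyclicity) k i j) := by
    refine ⟨(K : WithBot ℝ), ?_⟩
    rintro _ ⟨k, rfl⟩
    refine le_of_forall_coe_le fun x hx => ?_
    obtain ⟨w, hw, h⟩ := (coe_le_pow_smul_inv hl).1 (coe_le_pow_pow_iff.1 hx)
    exact WithBot.coe_le_coe.2 (hw.trans (hK _ _ _ _ h))
  refine le_trans ?_ (le_ciSup hb m)
  exact coe_le_pow_pow_iff.2 ((coe_le_pow_smul_inv hl).2 ⟨w, le_rfl, h⟩)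

/-- Moving a finite `b` to the other side makes it unnecessary to know that the supremum is
attained. -/
theorem iSup_add_le_of_forall {f : ℕ → WithBot ℝ} {b z : WithBot ℝ} (h : ∀ k, f k + b ≤ z) :
    (⨆ k, f k) + b ≤ z := by
  induction b with
  | bot => simp
  | coe b =>
    have h1 : ∀ k, f k ≤ z + ((-b : ℝ) : WithBot ℝ) := by
      intro k
      have h2 := add_le_add (h k) (le_refl ((-b : ℝ) : WithBot ℝ))
      rwa [add_assoc, ← WithBot.coe_add, add_neg_cancel, WithBot.coe_zero, add_zero] at h2
    have h2 := add_le_add (ciSup_le h1) (le_refl (b : WithBot ℝ))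
    rwa [add_assoc, ← WithBot.coe_add, neg_add_cancel, WithBot.coe_zero, add_zero] at h2

end Normalized

/-! ### The critical graph -/

section Critical

variable {n : ℕ} {A : Mat n} {l : ℝ}

theorem isCritical_walkList (hl : maxCycleMean A = l) {f : ℕ → Fin n} {L : ℕ} (hL : 1 ≤ L)
    (h0 : f L = f 0) (hs : ∀ s < L, (digraph A).edge (f s) (f (s + 1))) :
    IsCritical A (walkList f L) ↔ ∑ s ∈ Finset.Ico 0 L, subWeight A l (f s) (f (s + 1)) = 0 := by
  have hL' : (L : ℝ) ≠ 0 := by exact_mod_cast (by omega : L ≠ 0)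
  rw [IsCritical, isClosedWalk_walkList, len_walkList, mean_walkList hs, hl, WithBot.coe_inj,
    div_eq_iff hL']
  simp only [subWeight, Finset.sum_sub_distrib, Finset.sum_const, Nat.card_Ico, tsub_zero,
    nsmul_eq_mul]
  constructor
  · rintro ⟨-, -, h⟩
    linarith
  · intro h
    exact ⟨⟨⟨fun _ _ => Set.mem_univ _, hs⟩, h0⟩, hL, by linarith⟩

theorem exists_of_isCritical (hl : maxCycleMean A = l) {Z : List (Fin n)} (hZ : IsCritical A Z) :
    ∃ f, ∃ L ≥ 1, Z = walkList f L ∧ f L = f 0 ∧ (∀ s < L, (digraph A).edge (f s) (f (s + 1))) ∧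
      ∑ s ∈ Finset.Ico 0 L, subWeight A l (f s) (f (s + 1)) = 0 := by
  obtain ⟨f, hf⟩ := exists_eq_walkList hZ.1.1.1
  have hL := hZ.2.1
  generalize Digr.len Z = L at hf hL
  subst hf
  obtain ⟨⟨-, hs⟩, h0⟩ := isClosedWalk_walkList.1 hZ.1
  exact ⟨f, L, hL, rfl, h0, hs, (isCritical_walkList hl hL h0 hs).1 hZ⟩

theorem edge_of_critGraph_edge {i j : Fin n} (h : (critGraph A).edge i j) :
    (digraph A).edge i j := by
  obtain ⟨Z, hZ, hij⟩ := h
  obtain ⟨f, hf⟩ := exists_eq_walkList hZ.1.1.1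
  have h1 := hZ.1.1.2.2
  generalize Digr.len Z = L at hf
  subst hf
  obtain ⟨s, hs, rfl, rfl⟩ := pair_infix_walkList.1 hij
  exact isChain_walkList.1 h1 s hs

/-- A critical edge can be completed to a critical closed walk. -/
theorem critGraph_edge_return (hl : maxCycleMean A = l) {i j : Fin n}
    (h : (critGraph A).edge i j) :
    ∃ L, HasWalk (digraph A).edge (subWeight A l) j i L (-subWeight A l i j) := by
  obtain ⟨Z, hZ, hij⟩ := h
  obtain ⟨f, L, hL, rfl, h0, hs, hw⟩ := exists_of_isCritical hl hZ
  obtain ⟨s, hsL, rfl, rfl⟩ := pair_infix_walkList.1 hij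
  have h1 : HasWalk (digraph A).edge (subWeight A l) (f (s + 1)) (f L) (L - (s + 1)) _ :=
    HasWalk.ofFun (by omega) fun r _ h => hs r (by omega)
  have h2 : HasWalk (digraph A).edge (subWeight A l) (f 0) (f s) (s - 0) _ :=
    HasWalk.ofFun (by omega) fun r _ h => hs r (by omega)
  rw [h0] at h1
  refine ⟨_, (h1.trans h2).cast rfl ?_⟩
  rw [← Finset.sum_Ico_consecutive _ (Nat.zero_le (s + 1)) hsL,
    Finset.sum_Ico_succ_top (Nat.zero_le s)] at hw
  linarith

theorem critGraph_walk_return (hl : maxCycleMean A = l) {i j : Fin n} {L : ℕ} {w : ℝ}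
    (h : HasWalk (critGraph A).edge (subWeight A l) i j L w) :
    ∃ L', HasWalk (digraph A).edge (subWeight A l) j i L' (-w) := by
  induction h with
  | nil i => exact ⟨0, (HasWalk.nil i).cast rfl (by simp)⟩
  | cons e _ ih =>
    obtain ⟨L1, h1⟩ := ih
    obtain ⟨L2, h2⟩ := critGraph_edge_return hl e
    exact ⟨_, (h1.trans h2).cast rfl (by ring)⟩

/-- Both the closed walk, of weight `w`, and its return, of weight `-w`, are closed walks and hence
nonpositive. -/
theorem critGraph_closed_eq_zero (hl : maxCycleMean A = l) {v : Fin n} {L : ℕ} {w : ℝ}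
    (h : HasWalk (critGraph A).edge (subWeight A l) v v L w) : w = 0 := by
  obtain ⟨L', h'⟩ := critGraph_walk_return hl h
  have h1 := subWeight_nonpos hl _ _ _ h'
  have h2 := subWeight_nonpos hl _ _ _ (h.mono fun _ _ => edge_of_critGraph_edge)
  linarith

theorem critGraph_edge_of_cycle (hl : maxCycleMean A = l) {f : ℕ → Fin n} {L : ℕ} (hL : 1 ≤ L)
    (h0 : f L = f 0) (hs : ∀ s < L, (digraph A).edge (f s) (f (s + 1)))
    (hw : ∑ s ∈ Finset.Ico 0 L, subWeight A l (f s) (f (s + 1)) = 0) :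
    ∀ s < L, (critGraph A).edge (f s) (f (s + 1)) := fun s hsL =>
  ⟨walkList f L, (isCritical_walkList hl hL h0 hs).2 hw, pair_infix_walkList.2 ⟨s, hsL, rfl, rfl⟩⟩

/-- Every critical node is on a critical cycle. -/
theorem exists_critical_cycle (hl : maxCycleMean A = l) {v : Fin n}
    (hv : v ∈ (critGraph A).nodes) :
    ∃ z L, IsCycleFun (digraph A).edge z L ∧ z 0 = v ∧
      ∑ s ∈ Finset.Ico 0 L, subWeight A l (z s) (z (s + 1)) = 0 := by
  classical
  have hex : ∃ L, 1 ≤ L ∧ HasWalk (digraph A).edge (subWeight A l) v v L 0 := by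
    obtain ⟨Z, hZ, hvZ⟩ := hv
    obtain ⟨f, L, hL, rfl, h0, hs, hw⟩ := exists_of_isCritical hl hZ
    obtain ⟨s, hsL, rfl⟩ := mem_walkList.1 hvZ
    have h1 : HasWalk (digraph A).edge (subWeight A l) (f s) (f L) (L - s) _ :=
      HasWalk.ofFun hsL fun r _ h => hs r (by omega)
    have h2 : HasWalk (digraph A).edge (subWeight A l) (f 0) (f s) (s - 0) _ :=
      HasWalk.ofFun (by omega) fun r _ h => hs r (by omega)
    rw [h0] at h1
    rw [← Finset.sum_Ico_consecutive _ (Nat.zero_le s) hsL] at hw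
    exact ⟨L, hL, (h1.trans h2).cast (by omega) (by linarith)⟩
  have hmin := fun m => @Nat.find_min _ _ hex m
  obtain ⟨hL, h⟩ := Nat.find_spec hex
  generalize Nat.find hex = L at *
  obtain ⟨f, f0, fL, hs, hw⟩ := h.exists_fun
  -- A shortest closed walk of weight zero at `v` is a cycle: a repetition splits it into two
  -- nonpositive closed walks of total weight zero, so the one at `v` would be a shorter candidate.
  have key : ∀ x y, x < y → y < L → f x ≠ f y := by
    intro x y hxy hy he
    have h1 : HasWalk (digraph A).edge (subWeight A l) (f 0) (f x) (x - 0) _ :=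
      HasWalk.ofFun (Nat.zero_le x) fun s _ h => hs s (by omega)
    have h2 : HasWalk (digraph A).edge (subWeight A l) (f x) (f y) (y - x) _ :=
      HasWalk.ofFun hxy.le fun s _ h => hs s (by omega)
    have h3 : HasWalk (digraph A).edge (subWeight A l) (f y) (f L) (L - y) _ :=
      HasWalk.ofFun hy.le fun s _ h => hs s (by omega)
    rw [← he] at h2 h3
    have h4 := h1.trans h3
    rw [f0, fL] at h4
    have n1 := subWeight_nonpos hl _ _ _ h2
    have n2 := subWeight_nonpos hl _ _ _ h4
    rw [← Finset.sum_Ico_consecutive _ (Nat.zero_le x) (hxy.le.trans hy.le),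
      ← Finset.sum_Ico_consecutive _ hxy.le hy.le] at hw
    exact hmin (L - (y - x)) (by omega) ⟨by omega, h4.cast (by omega) (by linarith)⟩
  refine ⟨f, L, ⟨hL, fL.trans f0.symm, hs, fun x hx y hy he => ?_⟩, f0, hw⟩
  rcases lt_trichotomy x y with hlt | he' | hlt
  · exact absurd he (key x y hlt hy)
  · exact he'
  · exact absurd he.symm (key y x hlt hx)

end Critical

/-! ### Cyclicity and lengths of critical closed walks -/

section Cyclicity

variable {n : ℕ}

theorem exists_hasWalk_of_reflTransGen {V : Type*} {E : V → V → Prop} (a : V → V → ℝ) {i j : V}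
    (h : Relation.ReflTransGen E i j) : ∃ L w, HasWalk E a i j L w := by
  induction h with
  | refl => exact ⟨0, 0, HasWalk.nil i⟩
  | tail _ e ih =>
    obtain ⟨L, w, h⟩ := ih
    exact ⟨_, _, h.trans (HasWalk.single e)⟩

theorem HasWalk.reflTransGen {V : Type*} {E : V → V → Prop} {a : V → V → ℝ} {i j : V} {L : ℕ}
    {w : ℝ} (h : HasWalk E a i j L w) : Relation.ReflTransGen E i j := by
  induction h with
  | nil i => exact Relation.ReflTransGen.refl
  | cons e _ ih => exact Relation.ReflTransGen.head e ih

theorem isClosedWalk_scc {G : Digr n} {a : Fin n → Fin n → ℝ} {v : Fin n} (hv : v ∈ G.nodes)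
    {L : ℕ} {w : ℝ} (h : HasWalk G.edge a v v L w) :
    ∃ W, (G.scc v).IsClosedWalk W ∧ Digr.len W = L := by
  obtain ⟨f, f0, fL, hs, -⟩ := h.exists_fun
  have h1 : ∀ s ≤ L, Relation.ReflTransGen G.edge v (f s) ∧
      Relation.ReflTransGen G.edge (f s) v := by
    intro s hsL
    have h1 : HasWalk G.edge a (f 0) (f s) (s - 0) _ :=
      HasWalk.ofFun (Nat.zero_le s) fun r _ h => hs r (by omega)
    have h2 : HasWalk G.edge a (f s) (f L) (L - s) _ :=
      HasWalk.ofFun hsL fun r _ h => hs r (by omega)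
    rw [f0] at h1
    rw [fL] at h2
    exact ⟨h1.reflTransGen, h2.reflTransGen⟩
  refine ⟨walkList f L, isClosedWalk_walkList.2 ⟨⟨fun s hsL => ⟨?_, h1 s hsL⟩, fun s hsL =>
    ⟨hs s hsL, h1 s hsL.le, h1 (s + 1) hsL⟩⟩, fL.trans f0.symm⟩, len_walkList f L⟩
  rcases Nat.eq_zero_or_pos s with rfl | hp
  · rwa [f0]
  · have := G.right_mem (hs (s - 1) (by omega))
    rwa [show s - 1 + 1 = s by omega] at this

/-- The greatest common divisor of the lengths of the closed walks at `v` is the one of the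
component of `v`. -/
theorem setGcd_eq_closedWalkGcd {G : Digr n} (a : Fin n → Fin n → ℝ) {v : Fin n}
    (hv : v ∈ G.nodes) (hpos : ∃ L w, 1 ≤ L ∧ HasWalk G.edge a v v L w) :
    1 ≤ (G.scc v).closedWalkGcd ∧
      Nat.setGcd {L | ∃ w, HasWalk G.edge a v v L w} = (G.scc v).closedWalkGcd := by
  obtain ⟨L0, w0, hL0, h0⟩ := hpos
  obtain ⟨W0, hW0, hlen⟩ := isClosedWalk_scc hv h0
  -- A closed walk of positive length is needed here: without one, all integers are common divisors
  -- and the supremum takes its default value 0.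
  have hbdd : BddAbove {d | ∀ W, (G.scc v).IsClosedWalk W → d ∣ Digr.len W} :=
    ⟨L0, fun d hd => Nat.le_of_dvd hL0 (hlen ▸ hd W0 hW0)⟩
  have h1 : 1 ≤ (G.scc v).closedWalkGcd := le_csSup hbdd fun W _ => one_dvd _
  have hmem : ∀ W, (G.scc v).IsClosedWalk W → (G.scc v).closedWalkGcd ∣ Digr.len W :=
    Nat.sSup_mem (s := {d | ∀ W, (G.scc v).IsClosedWalk W → d ∣ Digr.len W})
      ⟨1, fun W _ => one_dvd _⟩ hbdd
  refine ⟨h1, le_antisymm (le_csSup hbdd ?_) (Nat.le_of_dvd ?_ (Nat.dvd_setGcd_iff.2 ?_))⟩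
  · intro W hW
    obtain ⟨f, hf⟩ := exists_eq_walkList hW.1.1
    generalize Digr.len W = L at hf ⊢
    subst hf
    obtain ⟨⟨hn, hs⟩, hc⟩ := isClosedWalk_walkList.1 hW
    obtain ⟨p, u, hp⟩ := exists_hasWalk_of_reflTransGen a (hn 0 (Nat.zero_le _)).2.1
    obtain ⟨q, x, hq⟩ := exists_hasWalk_of_reflTransGen a (hn 0 (Nat.zero_le _)).2.2
    have hm : HasWalk G.edge a (f 0) (f L) (L - 0) _ :=
      HasWalk.ofFun (Nat.zero_le L) fun r _ h => (hs r h).1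
    rw [hc] at hm
    -- A closed walk elsewhere in the component is a detour of a closed walk at `v`; its length is a
    -- difference of two lengths at `v`.
    have d1 := Nat.setGcd_dvd_of_mem (s := {L | ∃ w, HasWalk G.edge a v v L w}) ⟨_, hp.trans hq⟩
    have d2 := Nat.setGcd_dvd_of_mem (s := {L | ∃ w, HasWalk G.edge a v v L w})
      ⟨_, (hp.trans hm).trans hq⟩
    have h3 := Nat.dvd_sub d2 d1
    rwa [show p + (L - 0) + q - (p + q) = L by omega] at h3
  · refine Nat.pos_of_ne_zero fun hz => ?_
    have := Nat.setGcd_dvd_of_mem (s := {L | ∃ w, HasWalk G.edge a v v L w}) ⟨w0, h0⟩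
    rw [hz, zero_dvd_iff] at this
    omega
  · rintro m ⟨w, h⟩
    obtain ⟨W, hW, rfl⟩ := isClosedWalk_scc hv h
    exact hmem W hW

variable {A : Mat n} {l : ℝ}

theorem exists_critGraph_closed (hl : maxCycleMean A = l) {v : Fin n}
    (hv : v ∈ (critGraph A).nodes) :
    ∃ L w, 1 ≤ L ∧ HasWalk (critGraph A).edge (subWeight A l) v v L w := by
  obtain ⟨z, L, hz, z0, hw⟩ := exists_critical_cycle hl hv
  have h := critGraph_edge_of_cycle hl hz.1 hz.2.1 hz.2.2.1 hw
  have h1 : HasWalk (critGraph A).edge (subWeight A l) (z 0) (z L) (L - 0) _ :=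
    HasWalk.ofFun (Nat.zero_le L) fun r _ hr => h r hr
  rw [hz.2.1, z0] at h1
  exact ⟨_, _, hz.1, h1⟩

theorem cyclicity_pos (hl : maxCycleMean A = l) : 1 ≤ (critGraph A).cyclicity := by
  classical
  refine Nat.one_le_iff_ne_zero.2 fun h => ?_
  rw [Digr.cyclicity, Finset.lcm_eq_zero_iff] at h
  obtain ⟨v, hv, h0⟩ := h
  have hv' : v ∈ (critGraph A).nodes := by simpa using hv
  have := (setGcd_eq_closedWalkGcd (subWeight A l) hv' (exists_critGraph_closed hl hv')).1
  omega

/-- All sufficiently large multiples of the cyclicity are lengths of critical closed walks. -/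
theorem exists_closed_of_cyclicity_dvd (hl : maxCycleMean A = l) {v : Fin n}
    (hv : v ∈ (critGraph A).nodes) :
    ∃ m₀, ∀ m ≥ m₀, (critGraph A).cyclicity ∣ m →
      HasWalk (digraph A).edge (subWeight A l) v v m 0 := by
  classical
  -- A numerical semigroup contains all large multiples of its gcd, and the lengths of closed walks
  -- at `v` are closed under addition.
  obtain ⟨m₀, h⟩ := Nat.exists_mem_closure_of_ge
    {L | ∃ w, HasWalk (critGraph A).edge (subWeight A l) v v L w}
  refine ⟨m₀, fun m hm hd => ?_⟩
  have h1 := h m hm (by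
    rw [(setGcd_eq_closedWalkGcd (subWeight A l) hv (exists_critGraph_closed hl hv)).2]
    exact (Finset.dvd_lcm (f := fun v => ((critGraph A).scc v).closedWalkGcd)
      (Finset.mem_filter.2 ⟨Finset.mem_univ _, hv⟩)).trans hd)
  have h2 : ∃ w, HasWalk (critGraph A).edge (subWeight A l) v v m w := by
    clear hm hd
    induction h1 using AddSubmonoid.closure_induction with
    | mem x hx => exact hx
    | zero => exact ⟨0, HasWalk.nil v⟩
    | add x y _ _ hx hy =>
      obtain ⟨u, hu⟩ := hx
      obtain ⟨w, hw⟩ := hy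
      exact ⟨_, hu.trans hw⟩
  obtain ⟨w, hw⟩ := h2
  exact (hw.mono fun _ _ => edge_of_critGraph_edge).cast rfl (critGraph_closed_eq_zero hl hw)

end Cyclicity

/-! ### The CSR term in terms of walks -/

section CSRWalks

variable {n : ℕ} {A : Mat n} {l : ℝ}

theorem coe_le_pow_csrS (hl : maxCycleMean A = l) {t : ℕ} {i j : Fin n} {w : ℝ}
    (h : HasWalk (critGraph A).edge (subWeight A l) i j t w) :
    (w : WithBot ℝ) ≤ pow (csrS A (critGraph A)) t i j := by
  have hS : ∀ u v, (critGraph A).edge u v →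
      csrS A (critGraph A) u v = (subWeight A l u v : WithBot ℝ) := fun u v h => by
    rw [csrS, if_pos h, coe_subWeight hl (edge_of_critGraph_edge h)]
  refine coe_le_pow_iff.2 ⟨w, le_rfl, h.comap id (fun u v h => ?_) fun u v h => ?_⟩
  · change csrS A (critGraph A) u v ≠ ⊥
    rw [hS u v h]
    exact WithBot.coe_ne_bot
  · rw [id, id, realWeight, hS u v h, WithBot.unbotD_coe]

/-- Walks through critical nodes are dominated by the CSR term. -/
theorem coe_le_csr (hl : maxCycleMean A = l) {i j k : Fin n} (hk : k ∈ (critGraph A).nodes)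
    {p q : ℕ} {u v : ℝ} (hu : HasWalk (digraph A).edge (subWeight A l) i k p u)
    (hv : HasWalk (digraph A).edge (subWeight A l) k j q v) :
    ((u + v : ℝ) : WithBot ℝ) ≤ csr A (p + q) i j := by
  have hg := cyclicity_pos hl
  obtain ⟨L, w, hL, h⟩ := exists_critGraph_closed hl hk
  rw [critGraph_closed_eq_zero hl h] at h
  obtain ⟨g, hgdef⟩ : ∃ g, (critGraph A).cyclicity = g + 1 :=
    ⟨(critGraph A).cyclicity - 1, by omega⟩
  -- A critical closed walk of length `M` and weight zero is inserted at `k`, with γ = `g + 1`. Its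
  -- first `p * g` steps extend the part for C to length `p * γ`, the next `p + q` steps serve for
  -- S, and the rest goes to R. As γ divides `M`, the R part also has length divisible by γ; the
  -- final `+ 1` ensures that the last cut node has an outgoing critical edge.
  obtain ⟨M, hM⟩ : ∃ M, M = ((g + 1) * (p * (g + 1) + q + 1)) * L := ⟨_, rfl⟩
  have hMlarge : p * g + (p + q) + 1 ≤ M := by
    rw [hM]
    have h1 : p * (g + 1) + q + 1 ≤ (g + 1) * (p * (g + 1) + q + 1) :=
      Nat.le_mul_of_pos_left _ (Nat.succ_pos g)
    have h2 := Nat.le_mul_of_pos_right ((g + 1) * (p * (g + 1) + q + 1)) hL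
    have h3 : p * (g + 1) = p * g + p := by ring
    omega
  obtain ⟨f, f0, fM, fs, fw⟩ :=
    ((h.iterate ((g + 1) * (p * (g + 1) + q + 1))).cast hM.symm (mul_zero _)).exists_fun
  have h1 : HasWalk (critGraph A).edge (subWeight A l) (f 0) (f (p * g)) (p * g - 0) _ :=
    HasWalk.ofFun (Nat.zero_le _) fun r _ hr => fs r (by omega)
  have h2 : HasWalk (critGraph A).edge (subWeight A l) (f (p * g)) (f (p * g + (p + q)))
      (p * g + (p + q) - p * g) _ :=
    HasWalk.ofFun (by omega) fun r _ hr => fs r (by omega)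
  have h3 : HasWalk (critGraph A).edge (subWeight A l) (f (p * g + (p + q))) (f M)
      (M - (p * g + (p + q))) _ :=
    HasWalk.ofFun (by omega) fun r _ hr => fs r (by omega)
  rw [← Finset.sum_Ico_consecutive _ (Nat.zero_le _) (by omega : p * g + (p + q) ≤ M),
    ← Finset.sum_Ico_consecutive _ (Nat.zero_le (p * g)) (by omega)] at fw
  rw [f0] at h1
  rw [fM] at h3
  have hx : f (p * g) ∈ (critGraph A).nodes := (critGraph A).left_mem (fs _ (by omega))
  have hy : f (p * g + (p + q)) ∈ (critGraph A).nodes := (critGraph A).left_mem (fs _ (by omega))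
  have hE : ∀ u v, (critGraph A).edge u v → (digraph A).edge u v :=
    fun _ _ => edge_of_critGraph_edge
  rw [csr, coe_le_mul_iff]
  refine ⟨f (p * g + (p + q)),
    u + ∑ s ∈ Finset.Ico 0 (p * g), subWeight A l (f s) (f (s + 1)) +
      ∑ s ∈ Finset.Ico (p * g) (p * g + (p + q)), subWeight A l (f s) (f (s + 1)),
    ∑ s ∈ Finset.Ico (p * g + (p + q)) M, subWeight A l (f s) (f (s + 1)) + v,
    coe_le_mul_iff.2 ⟨f (p * g), _, _, ?_, coe_le_pow_csrS hl (h2.cast (by omega) rfl), le_rfl⟩,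
    ?_, by linarith⟩
  · rw [csrC, if_pos hx]
    refine coe_le_csrM (m := p) hl ((hu.trans (h1.mono hE)).cast ?_ rfl)
    rw [hgdef, mul_add, mul_one]
    omega
  · rw [csrR, if_pos hy]
    refine coe_le_csrM (m := (p * (g + 1) + q + 1) * L - p) hl
      (((h3.mono hE).trans hv).cast ?_ rfl)
    rw [hgdef, Nat.sub_mul]
    have e1 : (p * (g + 1) + q + 1) * L * (g + 1) = M := by rw [hM]; ring
    rw [e1]
    have e2 : p * (g + 1) = p * g + p := by ring
    omega

theorem mul_le_of_forall {A B : Mat n} {i j : Fin n} {z : WithBot ℝ}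
    (h : ∀ k, A i k + B k j ≤ z) : mul A B i j ≤ z :=
  Finset.sup_le fun k _ => h k

/-- For large exponents, the CSR term is dominated by the power of the matrix. -/
theorem csr_le_pow (hl : maxCycleMean A = l) {t : ℕ}
    (ht : IsLarge n (digraph A).circumference (digraph A).cabDiameter t) (i j : Fin n) :
    csr A t i j ≤ pow (smul (inv (maxCycleMean A)) A) t i j := by
  refine mul_le_of_forall fun y => ?_
  by_cases hy : y ∈ (critGraph A).nodes
  swap
  · rw [csrR, if_neg hy]; simp
  rw [csrR, if_pos hy, add_comm]
  refine iSup_add_le_of_forall fun k' => ?_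
  refine le_of_forall_coe_le fun r hr => ?_
  obtain ⟨v', r', hv', hr', hle⟩ := coe_le_add_iff.1 hr
  rw [mul, Finset.le_sup_iff (WithBot.bot_lt_coe r')] at hr'
  obtain ⟨x, -, hr'⟩ := hr'
  by_cases hx : x ∈ (critGraph A).nodes
  swap
  · rw [csrC, if_neg hx] at hr'; simp at hr'
  rw [csrC, if_pos hx] at hr'
  refine (WithBot.coe_le_coe.2 hle).trans ?_
  rw [WithBot.coe_add, add_comm]
  refine (add_le_add hr' le_rfl).trans ?_
  rw [add_assoc]
  refine iSup_add_le_of_forall fun k => ?_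
  refine le_of_forall_coe_le fun r hr => ?_
  obtain ⟨u', s', hu', hs', hle'⟩ := coe_le_add_iff.1 hr
  obtain ⟨s'', v'', hs'', hv'', hle''⟩ := coe_le_add_iff.1 hs'
  rw [WithBot.coe_le_coe] at hv''
  obtain ⟨u, hu, Hu⟩ := (coe_le_pow_smul_inv hl).1 (coe_le_pow_pow_iff.1 hu')
  obtain ⟨v, hv, Hv⟩ := (coe_le_pow_smul_inv hl).1 (coe_le_pow_pow_iff.1 hv')
  have hSle : ∀ i j, csrS A (critGraph A) i j ≤ smul (inv (maxCycleMean A)) A i j := by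
    intro i j
    rw [csrS]
    split_ifs
    · exact le_rfl
    · exact bot_le
  obtain ⟨w, hw, Hw⟩ := (coe_le_pow_smul_inv hl).1 (hs''.trans (pow_mono hSle t x y))
  obtain ⟨z, L, hz, z0, hzw⟩ := exists_critical_cycle hl hx
  obtain ⟨m₀, hm₀⟩ := exists_closed_of_cyclicity_dvd hl hx
  obtain ⟨L', rfl⟩ : ∃ L', L = L' + 1 := ⟨L - 1, by have := hz.1; omega⟩
  set g := (critGraph A).cyclicity with hgdef
  have hg : 1 ≤ g := cyclicity_pos hl
  -- The stars contribute `(k + k') * g` extra steps; adding `(k + k') * g * L'` makes this a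
  -- multiple of the cycle length `L' + 1`. The second term keeps that divisibility and makes the
  -- inserted length at least `m₀`.
  have Hx := hm₀ ((k + k') * g * L' + g * m₀ * (L' + 1)) (by
    have h1 := Nat.le_mul_of_pos_left m₀ hg
    have h2 := Nat.le_mul_of_pos_right (g * m₀) (Nat.succ_pos L')
    exact (h1.trans h2).trans (Nat.le_add_left _ _))
    ⟨(k + k') * L' + m₀ * (L' + 1), by ring⟩
  have hc : Conn (digraph A).edge (subWeight A l) ((Finset.range (L' + 1)).image z) i j _ _ :=
    ⟨x, Finset.mem_image.2 ⟨0, by simp, z0⟩, _, _, _, _, Hu.trans Hx, Hw.trans Hv, rfl, le_rfl⟩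
  obtain ⟨w', hw', H⟩ := hc.exists_hasWalk_of_isLarge (t := t) (Fintype.card_fin n)
    (subWeight_nonpos hl)
    (fun f p hs hinj => le_cabDiameter hs hinj) hz.1 hz.le_circumference hz.2.2.1 hz.2.1
    hz.2.2.2 hzw (by
      refine ((Nat.modEq_iff_dvd' ?_).2 ?_).symm
      · omega
      · refine ⟨(k + k') * g + g * m₀, ?_⟩
        refine Nat.sub_eq_of_eq_add ?_
        ring) ht
  exact (coe_le_pow_smul_inv hl).2 ⟨w', by linarith, H⟩

end CSRWalks

/-! ### Rerouting through the cycle threshold graph; the weak CSR expansion -/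

section Subordinate

theorem Conn.sub_const {V : Type*} {E : V → V → Prop} {a : V → V → ℝ} {N : Finset V} {i j : V}
    {t : ℕ} {w : ℝ} (c : ℝ) (h : Conn E a N i j t w) :
    Conn E (fun u v => a u v - c) N i j t (w - c * t) := by
  obtain ⟨k, hk, p, q, u, v, h1, h2, rfl, h4⟩ := h
  exact ⟨k, hk, p, q, _, _, h1.sub_const c, h2.sub_const c, rfl, by push_cast; linarith⟩

theorem Conn.of_sub_const {V : Type*} {E : V → V → Prop} {a : V → V → ℝ} {N : Finset V}
    {i j : V} {t : ℕ} {w : ℝ} (c : ℝ) (h : Conn E (fun u v => a u v - c) N i j t (w - c * t)) :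
    Conn E a N i j t w := by
  obtain ⟨k, hk, p, q, u, v, h1, h2, rfl, h4⟩ := h
  refine ⟨k, hk, p, q, _, _, h1.of_sub_const c, h2.of_sub_const c, rfl, ?_⟩
  push_cast at h4
  linarith

theorem Conn.mono {V : Type*} {E E' : V → V → Prop} {a : V → V → ℝ} {N : Finset V} {i j : V}
    {t : ℕ} {w : ℝ} (hE : ∀ u v, E u v → E' u v) (h : Conn E a N i j t w) :
    Conn E' a N i j t w := by
  obtain ⟨k, hk, p, q, u, v, h1, h2, h3, h4⟩ := h
  exact ⟨k, hk, p, q, u, v, h1.mono hE, h2.mono hE, h3, h4⟩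

theorem Conn.exists_fun {V : Type*} {E : V → V → Prop} {a : V → V → ℝ} {k : V} {i j : V}
    {t : ℕ} {w : ℝ} (h : Conn E a {k} i j t w) :
    ∃ f : ℕ → V, f 0 = i ∧ f t = j ∧ (∀ s < t, E (f s) (f (s + 1))) ∧ (∃ s ≤ t, f s = k) ∧
      w ≤ ∑ s ∈ Finset.Ico 0 t, a (f s) (f (s + 1)) := by
  obtain ⟨k', hk', p, q, u, v, h1, h2, rfl, h4⟩ := h
  rw [Finset.mem_singleton] at hk'
  subst hk'
  obtain ⟨f, f0, fp, fs, rfl⟩ := h1.exists_fun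
  obtain ⟨g, g0, gq, gs, rfl⟩ := h2.exists_fun
  obtain ⟨F, e1, e2⟩ : ∃ F : ℕ → V, (∀ s ≤ p, F s = f s) ∧ ∀ s, F (p + s) = g s := by
    refine ⟨fun s => if s ≤ p then f s else g (s - p), fun s hs => if_pos hs, fun s => ?_⟩
    rcases Nat.eq_zero_or_pos s with rfl | hs
    · simp [g0, fp]
    · simp [hs.ne']
  refine ⟨F, (e1 0 (Nat.zero_le p)).trans f0, (e2 q).trans gq, ?_,
    ⟨p, Nat.le_add_right p q, (e1 p le_rfl).trans fp⟩, ?_⟩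
  · intro s hs
    rcases Nat.lt_or_ge s p with h | h
    · rw [e1 s h.le, e1 (s + 1) h]
      exact fs s h
    · obtain ⟨s, rfl⟩ := Nat.exists_eq_add_of_le h
      rw [add_assoc, e2, e2]
      exact gs _ (by omega)
  · rw [← Finset.sum_Ico_consecutive _ (Nat.zero_le p) (Nat.le_add_right p q)]
    refine h4.trans (add_le_add (le_of_eq ?_) (le_of_eq ?_))
    · refine Finset.sum_congr rfl fun s hs => ?_
      have := (Finset.mem_Ico.1 hs).2
      rw [e1 s this.le, e1 (s + 1) this]
    · rw [Finset.sum_Ico_eq_sum_range, Finset.sum_Ico_eq_sum_range, Nat.sub_zero,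
        Nat.add_sub_cancel_left]
      refine Finset.sum_congr rfl fun s _ => ?_
      rw [add_assoc p, e2, e2, zero_add]

variable {n : ℕ} {A : Mat n} {l : ℝ}

/-- If `q` is the only critical node, then it has a critical loop. -/
theorem critical_loop (hl : maxCycleMean A = l) {q : Fin n} (hq : q ∈ (critGraph A).nodes)
    (huniq : ∀ v ∈ (critGraph A).nodes, v = q) :
    (digraph A).edge q q ∧ realWeight A q q = l := by
  obtain ⟨z, L, hz, z0, hw⟩ := exists_critical_cycle hl hq
  have he := critGraph_edge_of_cycle hl hz.1 hz.2.1 hz.2.2.1 hw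
  have h1 : z 1 = q := huniq _ ((critGraph A).right_mem (he 0 hz.1))
  have hL : L = 1 := by
    by_contra hne
    have := hz.1
    have := hz.2.2.2 0 (by omega) 1 (by omega) (z0.trans h1.symm)
    omega
  subst hL
  have h2 := hz.2.2.1 0 Nat.one_pos
  rw [zero_add, z0, h1] at h2
  refine ⟨h2, ?_⟩
  rw [Nat.Ico_succ_singleton, Finset.sum_singleton, zero_add, z0, h1, subWeight] at hw
  linarith

/-- Above the level `muCT A`, every component of a cycle threshold graph contains critical nodes. -/
theorem exists_critical_of_muCT_lt {Z : List (Fin n)} (hZ : (digraph A).IsCycle Z)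
    (hmu : muCT A < mean A Z) {v : Fin n} (hv : v ∈ Z) :
    ∃ q ∈ (critGraph A).nodes,
      Relation.ReflTransGen (cycleThresholdGraph A (mean A Z)).edge v q := by
  by_contra hcon
  push Not at hcon
  -- Otherwise the component of `v` at level `mean A Z` contains no critical component, and this
  -- mean competes in the supremum defining `muCT A`.
  refine hmu.not_ge (le_csSup ⟨maxCycleMean A, fun _ h => h.1⟩ ⟨le_maxCycleMean hZ,
    (cycleThresholdGraph A (mean A Z)).scc v, ⟨v, ⟨Z, ⟨hZ, le_rfl⟩, hv⟩, rfl⟩, ?_⟩)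
  rintro K ⟨u, hu, rfl⟩ hsub
  exact hcon u hu (hsub.1 ⟨hu, Relation.ReflTransGen.refl, Relation.ReflTransGen.refl⟩).2.1

theorem exists_of_threshold_edge {ν : WithBot ℝ} {u v : Fin n}
    (h : (cycleThresholdGraph A ν).edge u v) :
    ∃ z L, IsCycleFun (digraph A).edge z L ∧ ν ≤ mean A (walkList z L) ∧
      ∃ s < L, z s = u ∧ z (s + 1) = v := by
  obtain ⟨Z, ⟨hZ, hν⟩, huv⟩ := h
  obtain ⟨z, hz, hc⟩ := exists_of_isCycle hZ
  generalize Digr.len Z = L at hz hc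
  subst hz
  exact ⟨z, L, hc, hν, pair_infix_walkList.1 huv⟩

/-- A walk that visits a node connected to the critical graph in a cycle threshold graph can be
rerouted to the first node on the connection, if its own cycles are below the threshold. -/
theorem Conn.reroute (hl : maxCycleMean A = l) {t : ℕ}
    (ht : IsLarge n (digraph A).circumference (digraph A).cabDiameter t) {i j : Fin n} {w : ℝ}
    {ν : ℝ} {q : Fin n} (hq : q ∈ (critGraph A).nodes)
    (hno : ∀ q ∈ (critGraph A).nodes, ¬ Conn (digraph A).edge (realWeight A) {q} i j t w)
    {f : ℕ → Fin n} (f0 : f 0 = i) (ft : f t = j)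
    (fs : ∀ s < t, (digraph A).edge (f s) (f (s + 1)))
    (fw : w ≤ ∑ s ∈ Finset.Ico 0 t, realWeight A (f s) (f (s + 1)))
    (hcyc : ∀ g L, IsCycleFun (fun u v => ∃ s < t, f s = u ∧ f (s + 1) = v) g L →
      mean A (walkList g L) ≤ ν)
    {r : ℕ} (hr : r ≤ t) {v : Fin n} (he : (cycleThresholdGraph A ν).edge (f r) v) :
    Conn (digraph A).edge (realWeight A) {v} i j t w := by
  classical
  -- Cycle removal is confined to the edges of the walk itself, whose cycles become nonpositive
  -- after subtracting `ν`; the cycle to be inserted lives in the full digraph.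
  set E' : Fin n → Fin n → Prop := fun u v => ∃ s < t, f s = u ∧ f (s + 1) = v
  have hE' : ∀ u v, E' u v → (digraph A).edge u v := by
    rintro u v ⟨s, hs, rfl, rfl⟩
    exact fs s hs
  obtain ⟨z, L, hz, hzν, m, hm, hzm, hzm'⟩ := exists_of_threshold_edge he
  obtain ⟨hL, hz0, hzE, hzinj⟩ := hz
  have hLpos : (0 : ℝ) < L := by exact_mod_cast hL
  have hνl : ν ≤ l := by
    rw [← WithBot.coe_le_coe, ← hl]
    exact hzν.trans (le_maxCycleMean (isCycle_walkList.2 ⟨hL, hz0, hzE, hzinj⟩))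
  set a' : Fin n → Fin n → ℝ := fun u v => realWeight A u v - ν with ha'
  set N := (Finset.range L).image z with hNdef
  have hNcard : N.card = L := by
    rw [hNdef, Finset.card_image_of_injOn, Finset.card_range]
    intro x hx y hy
    simp only [Finset.coe_range, Set.mem_Iio] at hx hy
    exact hzinj x hx y hy
  have hcirc : IsCircuit (digraph A).edge a' N L := by
    refine IsCircuit.ofFun hzE hz0 ?_
    rw [mean_walkList hzE, WithBot.coe_le_coe, le_div_iff₀ hLpos] at hzν
    simp only [ha', Finset.sum_sub_distrib, Finset.sum_const, Nat.card_Ico, tsub_zero,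
      nsmul_eq_mul]
    linarith
  have hrN : f r ∈ N := Finset.mem_image.2 ⟨m, Finset.mem_range.2 hm, hzm⟩
  have hvN : v ∈ N := by
    rcases Nat.lt_or_ge (m + 1) L with h | h
    · exact Finset.mem_image.2 ⟨m + 1, Finset.mem_range.2 h, hzm'⟩
    · refine Finset.mem_image.2 ⟨0, Finset.mem_range.2 hL, ?_⟩
      rw [← hz0, ← hzm']
      congr 1
      omega
  set M := (Finset.range (t + 1)).image f with hMdef
  have hMmem : ∀ s ≤ t, f s ∈ M := fun s hs =>
    Finset.mem_image.2 ⟨s, Finset.mem_range.2 (by omega), rfl⟩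
  have hMcrit : ∀ x ∈ (critGraph A).nodes, x ∉ M := by
    intro x hx hxM
    obtain ⟨s, hs, rfl⟩ := Finset.mem_image.1 hxM
    rw [Finset.mem_range] at hs
    refine hno _ hx ?_
    rw [← f0, ← ft]
    exact Conn.ofFun (by omega) (Finset.mem_singleton_self _) fs fw
  -- The walk meets no critical node, so it misses `q`.
  have hMn : M.card + 1 ≤ n := by
    have h1 : (insert q M).card ≤ n := (Finset.card_le_univ _).trans_eq (Fintype.card_fin n)
    rwa [Finset.card_insert_of_notMem (hMcrit q hq)] at h1
  have hneg : ∀ v L w, HasWalk E' a' v v L w → w ≤ 0 := by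
    refine HasWalk.nonpos_of_simple fun g L hL h0 hs hinj => ?_
    have h1 := hcyc g L ⟨hL, h0.symm, hs, hinj⟩
    have hLpos : (0 : ℝ) < L := by exact_mod_cast hL
    rw [mean_walkList fun s h => hE' _ _ (hs s h), WithBot.coe_le_coe, div_le_iff₀ hLpos] at h1
    simp only [ha', Finset.sum_sub_distrib, Finset.sum_const, Nat.card_Ico, tsub_zero,
      nsmul_eq_mul]
    linarith
  have hiM : i ∈ M := f0 ▸ hMmem 0 (Nat.zero_le t)
  have hEM : ∀ u v, E' u v → v ∈ M := by
    rintro u v ⟨s, hs, rfl, rfl⟩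
    exact hMmem (s + 1) hs
  have hconn : Conn E' a' N i j t (w - ν * t) := by
    have h1 : Conn E' (realWeight A) N (f 0) (f t) t w :=
      Conn.ofFun hr hrN (fun s hs => ⟨s, hs, rfl, rfl⟩) fw
    rw [f0, ft] at h1
    exact h1.sub_const ν
  rcases hconn.reduce_of_isLarge (Fintype.card_fin n) hneg
    (fun g p hs hinj => le_cabDiameter (fun s h => hE' _ _ (hs s h)) hinj) hL
    (IsCycleFun.le_circumference ⟨hL, hz0, hzE, hzinj⟩) hNcard hMn hiM hEM ht with
    ⟨t', ht', hmod, h⟩ | ⟨hNu, hMc, htn⟩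
  · exact ((h.mono hE').pad_visit hcirc ht' hmod hvN).of_sub_const ν
  -- The walk misses only `q`, which is thus the only critical node and carries a critical loop,
  -- while the inserted cycle is Hamiltonian. Removing all loops leaves at most `n - 2` steps, one
  -- Hamiltonian turn gives at most `2 * n - 2 ≤ t` steps through `q`, and the loop fills up to `t`.
  · exfalso
    have huniq : ∀ x ∈ (critGraph A).nodes, x = q := by
      intro x hx
      by_contra hne
      have h1 : (insert x (insert q M)).card ≤ n :=
        (Finset.card_le_univ _).trans_eq (Fintype.card_fin n)
      rw [Finset.card_insert_of_notMem, Finset.card_insert_of_notMem (hMcrit q hq)] at h1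
      · omega
      · rw [Finset.mem_insert]
        exact fun h => h.elim hne (hMcrit x hx)
    obtain ⟨hqq, hqw⟩ := critical_loop hl hq huniq
    have hLn : L = n := by rw [← hNcard, hNu, Finset.card_univ, Fintype.card_fin]
    have hMpos : 0 < M.card := Finset.card_pos.2 ⟨i, hiM⟩
    have hqN : q ∈ N := hNu ▸ Finset.mem_univ q
    obtain ⟨t', ht', -, h⟩ := hconn.exists_le (l := 1) (B := M.card - 1) fun t ht h =>
      h.reduce_of_card hneg le_rfl hiM hEM (by
        rw [hNu, Finset.inter_univ, Finset.sdiff_eq_empty_iff_subset.2 (Finset.subset_univ M),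
          Finset.card_empty]
        omega)
    have h1 := (h.mono hE').pad_visit hcirc (t := t' + L) (by omega) (by simp [Nat.ModEq]) hqN
    have hloop : IsCircuit (digraph A).edge a' {q} 1 := by
      intro x hx y hy
      rw [Finset.mem_singleton] at hx hy
      rw [hx, hy]
      refine ⟨q, Finset.mem_singleton_self q, 0, 1, 0, _, HasWalk.nil q, HasWalk.single hqq, rfl, ?_⟩
      simp only [ha', hqw]
      linarith
    refine hno q hq (Conn.of_sub_const ν ?_)
    rcases (show t' + L ≤ t by omega).lt_or_eq with hlt | heq
    · exact h1.pad_visit hloop hlt (Nat.modEq_one) (Finset.mem_singleton_self q)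
    · exact heq ▸ h1

/-- A walk of large length that visits a node connected to the critical graph in a cycle threshold
graph of level at least `muCT A` is dominated by a walk through a critical node. -/
theorem Conn.exists_critical (hl : maxCycleMean A = l) {t : ℕ}
    (ht : IsLarge n (digraph A).circumference (digraph A).cabDiameter t) {i j : Fin n} {w : ℝ}
    {ν : ℝ} (hν : muCT A ≤ ν) {k q : Fin n} (hq : q ∈ (critGraph A).nodes)
    (hkq : Relation.ReflTransGen (cycleThresholdGraph A ν).edge k q)
    (h : Conn (digraph A).edge (realWeight A) {k} i j t w) :
    ∃ q ∈ (critGraph A).nodes, Conn (digraph A).edge (realWeight A) {q} i j t w := by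
  by_contra hno
  push Not at hno
  -- The outer induction is on the number of cycle means above `ν`, the inner one along the
  -- connection from `k` to `q`.
  induction hc : ({m ∈ (finite_cycleMeans A).toFinset | (ν : WithBot ℝ) < m}).card using
    Nat.strong_induction_on generalizing ν k q with
  | _ N ih =>
  induction hkq using Relation.ReflTransGen.head_induction_on with
  | refl => exact hno q hq h
  | @head k k' he _ ih' =>
    refine ih' ?_
    obtain ⟨f, f0, ft, fs, ⟨r, hr, rfl⟩, fw⟩ := h.exists_fun
    refine Conn.reroute hl ht hq hno f0 ft fs fw (fun g L hg => ?_) hr he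
    by_contra hlt
    rw [not_le] at hlt
    have hgE : IsCycleFun (digraph A).edge g L := by
      refine ⟨hg.1, hg.2.1, fun s hs => ?_, hg.2.2.2⟩
      obtain ⟨s', hs', e1, e2⟩ := hg.2.2.1 s hs
      rw [← e1, ← e2]
      exact fs s' hs'
    have hZ := isCycle_walkList.2 hgE
    -- The walk has a cycle of mean above `ν`: restart at this mean from a node of that cycle, with
    -- fewer means left above.
    obtain ⟨q', hq', hreach⟩ := exists_critical_of_muCT_lt hZ (hν.trans_lt hlt)
      (mem_walkList.2 ⟨0, Nat.zero_le L, rfl⟩)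
    obtain ⟨s', hs', e1, -⟩ := hg.2.2.1 0 hg.1
    obtain ⟨ν', hν'⟩ := WithBot.ne_bot_iff_exists.1 (mean_ne_bot hZ)
    rw [← hν'] at hlt hreach
    refine ih _ ?_ (hν.trans hlt.le) hq' hreach ?_ rfl
    · rw [← hc]
      refine Finset.card_lt_card (Finset.ssubset_iff_of_subset ?_ |>.2 ⟨(ν' : WithBot ℝ), ?_, ?_⟩)
      · intro m hm
        rw [Finset.mem_filter] at hm ⊢
        exact ⟨hm.1, hlt.trans hm.2⟩
      · rw [Finset.mem_filter]
        exact ⟨(Set.Finite.mem_toFinset _).2 ⟨_, hZ, hν'.symm⟩, hlt⟩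
      · simp
    · rw [← e1, ← f0, ← ft]
      exact Conn.ofFun hs'.le (Finset.mem_singleton_self _) fs fw

/-- An edge that can be closed to a closed walk is on a cycle. -/
theorem exists_cycle_of_edge {u v : Fin n} (he : (digraph A).edge u v)
    (h : Relation.ReflTransGen (digraph A).edge v u) :
    ∃ z L, IsCycleFun (digraph A).edge z L ∧ ∃ s < L, z s = u ∧ z (s + 1) = v := by
  classical
  have hex : ∃ L w, HasWalk (digraph A).edge (realWeight A) v u L w :=
    exists_hasWalk_of_reflTransGen _ h
  have hmin := fun m => @Nat.find_min _ _ hex m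
  obtain ⟨w, hw⟩ := Nat.find_spec hex
  generalize Nat.find hex = L at *
  obtain ⟨f, f0, fL, fs, -⟩ := hw.exists_fun
  have key : ∀ x y, x < y → y ≤ L → f x ≠ f y := by
    intro x y hxy hy hv
    have h1 : HasWalk (digraph A).edge (realWeight A) (f 0) (f x) (x - 0) _ :=
      HasWalk.ofFun (Nat.zero_le x) fun s _ h => fs s (by omega)
    have h3 : HasWalk (digraph A).edge (realWeight A) (f y) (f L) (L - y) _ :=
      HasWalk.ofFun hy fun s _ h => fs s (by omega)
    rw [f0, hv] at h1
    rw [fL] at h3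
    exact hmin _ (by omega) ⟨_, h1.trans h3⟩
  obtain ⟨F, e1, e2⟩ : ∃ F : ℕ → Fin n, (∀ s ≤ L, F s = f s) ∧ F (L + 1) = v :=
    ⟨fun s => if s ≤ L then f s else v, fun s hs => if_pos hs, if_neg (by omega)⟩
  refine ⟨F, L + 1, ⟨by omega, ?_, ?_, ?_⟩, L, by omega, (e1 L le_rfl).trans fL, e2⟩
  · rw [e2, e1 0 (Nat.zero_le L), f0]
  · intro s hs
    rcases (Nat.lt_succ_iff.1 hs).lt_or_eq with h | rfl
    · rw [e1 s h.le, e1 (s + 1) h]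
      exact fs s h
    · rw [e1 s le_rfl, e2, fL]
      exact he
  · intro x hx y hy hxy
    rw [e1 x (by omega), e1 y (by omega)] at hxy
    rcases lt_trichotomy x y with hlt | he' | hlt
    · exact absurd hxy (key x y hlt (by omega))
    · exact he'
    · exact absurd hxy.symm (key y x hlt (by omega))

/-- Nodes of the cycle threshold scheme are connected to critical nodes in a cycle threshold graph
of level at least `muCT A`. -/
theorem exists_threshold_of_mem_ctNodes {k : Fin n} (hk : k ∈ ctNodes A) :
    ∃ ν : ℝ, muCT A ≤ ν ∧ ∃ q ∈ (critGraph A).nodes,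
      Relation.ReflTransGen (cycleThresholdGraph A ν).edge k q := by
  obtain ⟨H, ⟨v, -, rfl⟩, ⟨q, hqH, hq⟩, hkH⟩ := hk
  have hkq := hkH.2.2.trans hqH.2.1
  have hqk := hqH.2.2.trans hkH.2.1
  unfold ctLevelGraph at hkq hqk
  split_ifs at hkq hqk with hmu
  -- When `muCT A = ⊥`, any real `ν` below all cycle means serves: an edge inside a component lies
  -- on a cycle, hence in the threshold graph of level `ν`.
  · have hinj : Function.Injective (WithBot.some : ℝ → WithBot ℝ) := WithBot.coe_injective
    obtain ⟨ν, hν⟩ := ((finite_cycleMeans A).preimage (f := (WithBot.some : ℝ → WithBot ℝ))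
      hinj.injOn).bddBelow
    have hlow : ∀ Z, (digraph A).IsCycle Z → (ν : WithBot ℝ) ≤ mean A Z := by
      intro Z hZ
      obtain ⟨x, hx⟩ := WithBot.ne_bot_iff_exists.1 (mean_ne_bot hZ)
      rw [← hx, WithBot.coe_le_coe]
      exact hν ⟨Z, hZ, hx.symm⟩
    refine ⟨ν, hmu ▸ bot_le, q, hq, ?_⟩
    clear hkH
    induction hkq using Relation.ReflTransGen.head_induction_on with
    | refl => exact Relation.ReflTransGen.refl
    | @head k k' he hk'q ih =>
      obtain ⟨z, L, hz, hs⟩ := exists_cycle_of_edge he (hk'q.trans hqk)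
      have hZ := isCycle_walkList.2 hz
      exact Relation.ReflTransGen.head ⟨_, ⟨hZ, hlow _ hZ⟩, pair_infix_walkList.2 hs⟩
        (ih (hqk.tail he))
  · obtain ⟨ν, hν⟩ := WithBot.ne_bot_iff_exists.1 hmu
    exact ⟨ν, hν.ge, q, hq, hν ▸ hkq⟩

theorem Bct_le (A : Mat n) (i j : Fin n) : Bct A i j ≤ A i j := by
  rw [Bct]
  split_ifs
  · exact bot_le
  · exact le_rfl

/-- The weak CSR expansion holds for large exponents. -/
theorem weakCSR_of_isLarge (hl : maxCycleMean A = l) {t : ℕ}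
    (ht : IsLarge n (digraph A).circumference (digraph A).cabDiameter t) :
    pow A t = oplus (smul (t • maxCycleMean A) (csr A t)) (pow (Bct A) t) := by
  have hsm : t • maxCycleMean A = ((l * t : ℝ) : WithBot ℝ) := by
    rw [hl, ← WithBot.coe_nsmul, nsmul_eq_mul, mul_comm]
  rw [hsm]
  funext i j
  refine le_antisymm (le_of_forall_coe_le fun x hx => ?_) (sup_le ?_ (pow_mono (Bct_le A) t i j))
  · obtain ⟨w, hw, h⟩ := coe_le_pow_iff.1 hx
    obtain ⟨f, f0, ft, fs, fw⟩ := h.exists_fun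
    by_cases hct : ∃ s ≤ t, f s ∈ ctNodes A
    · refine le_trans ?_ le_sup_left
      obtain ⟨s, hs, hk⟩ := hct
      obtain ⟨ν, hν, q, hq, hreach⟩ := exists_threshold_of_mem_ctNodes hk
      have hconn : Conn (digraph A).edge (realWeight A) {f s} (f 0) (f t) t w :=
        Conn.ofFun hs (Finset.mem_singleton_self _) fs fw.ge
      rw [f0, ft] at hconn
      obtain ⟨q', hq', hc⟩ := hconn.exists_critical hl ht hν hq hreach
      obtain ⟨k, hk, p, r, u, v, h1, h2, rfl, h4⟩ := hc
      rw [Finset.mem_singleton] at hk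
      subst hk
      have h5 := coe_le_csr hl hq' (h1.sub_const l) (h2.sub_const l)
      refine le_trans ?_ (add_le_add le_rfl h5)
      rw [← WithBot.coe_add, WithBot.coe_le_coe]
      push_cast
      linarith
    · refine le_trans ?_ le_sup_right
      push Not at hct
      have hB : ∀ s < t, Bct A (f s) (f (s + 1)) = A (f s) (f (s + 1)) := by
        intro s hs
        rw [Bct, if_neg]
        rintro (h | h)
        · exact hct s hs.le h
        · exact hct (s + 1) hs h
      have h1 : HasWalk (digraph (Bct A)).edge (realWeight (Bct A)) (f 0) (f t) (t - 0) _ :=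
        HasWalk.ofFun (Nat.zero_le t) fun s _ hs => by
          change Bct A (f s) (f (s + 1)) ≠ ⊥
          rw [hB s hs]
          exact fs s hs
      rw [f0, ft] at h1
      refine coe_le_pow_iff.2 ⟨_, ?_, h1⟩
      refine hw.trans_eq (fw.symm.trans (Finset.sum_congr rfl fun s hs => ?_))
      rw [realWeight, realWeight, hB s (Finset.mem_Ico.1 hs).2]
  · refine (add_le_add le_rfl (csr_le_pow hl ht i j)).trans (le_of_forall_coe_le fun x hx => ?_)
    obtain ⟨u, v, hu, hv, hle⟩ := coe_le_add_iff.1 hx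
    rw [WithBot.coe_le_coe] at hu
    obtain ⟨w, hw, h⟩ := (coe_le_pow_smul_inv hl).1 hv
    exact coe_le_pow_iff.2 ⟨_, by linarith, HasWalk.of_sub_const l h⟩

/-- Without cycles the weak CSR expansion is trivial. -/
theorem weakCSR_of_eq_bot (hA : maxCycleMean A = ⊥) (t : ℕ) :
    pow A t = oplus (smul (t • maxCycleMean A) (csr A t)) (pow (Bct A) t) := by
  have hcrit : ∀ v, v ∉ (critGraph A).nodes := by
    rintro v ⟨Z, hZ, -⟩
    obtain ⟨f, hf⟩ := exists_eq_walkList hZ.1.1.1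
    have h1 := hZ.1.1.2.2
    have h2 := hZ.2.2
    generalize Digr.len Z = L at hf
    subst hf
    rw [mean_walkList (isChain_walkList.1 h1), hA] at h2
    exact WithBot.coe_ne_bot h2
  have hB : Bct A = A := by
    funext i j
    have hct : ∀ v, v ∉ ctNodes A := by
      rintro v ⟨H, -, ⟨q, -, hq⟩, -⟩
      exact hcrit q hq
    rw [Bct, if_neg (fun h => h.elim (hct i) (hct j))]
  funext i j
  -- The CSR term is `⊥` whatever the scalar is; for `t = 0` the factor `t • ⊥` is 0, not `⊥`.
  have hcsr : csr A t i j = ⊥ := by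
    refine le_bot_iff.1 (mul_le_of_forall fun k => ?_)
    rw [csrR, if_neg (hcrit k), WithBot.add_bot]
  rw [oplus, smul, hcsr, WithBot.add_bot, hB, bot_sup_eq]

theorem one_le_circumference (hl : maxCycleMean A = l) : 1 ≤ (digraph A).circumference := by
  by_contra hcon
  have hempty : {m | ∃ Z, (digraph A).IsCycle Z ∧ mean A Z = m} = ∅ := by
    refine Set.eq_empty_of_forall_notMem ?_
    rintro m ⟨Z, hZ, -⟩
    obtain ⟨f, -, hf⟩ := exists_of_isCycle hZ
    have := hf.le_circumference
    have := hf.1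
    omega
  rw [maxCycleMean, hempty, WithBot.sSup_empty] at hl
  exact WithBot.coe_ne_bot hl.symm

end Subordinate

end MaxPlus

/-! ### The three bounds -/

theorem theorem4p4 (n : ℕ) (hn : 1 ≤ n) (A : MaxPlus.Mat n) (c d : ℕ)
    (hc : c = (MaxPlus.digraph A).circumference) (hd : d = (MaxPlus.digraph A).cabDiameter) :
    ∃ T₁ : ℕ, MaxPlus.IsWeakCSRThreshold A (MaxPlus.Bct A) T₁ ∧
      T₁ ≤ MaxPlus.wielandt n ∧
      (T₁ : ℤ) ≤ ((n : ℤ) - 1) * c + min (n : ℤ) (d + c + 1) ∧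
      (T₁ : ℤ) ≤ ((d : ℤ) + c - 1) * c + d + 1 := by
  set S : Set ℕ := {T : ℕ | ∀ t, T ≤ t → MaxPlus.pow A t =
    MaxPlus.oplus (MaxPlus.smul (t • MaxPlus.maxCycleMean A) (MaxPlus.csr A t))
      (MaxPlus.pow (MaxPlus.Bct A) t)} with hS
  have key : ∀ T ∈ S, MaxPlus.IsWeakCSRThreshold A (MaxPlus.Bct A) (sInf S) ∧ sInf S ≤ T :=
    fun T hT => ⟨⟨Nat.sInf_mem ⟨T, hT⟩, fun _ h => Nat.sInf_le h⟩, Nat.sInf_le hT⟩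
  obtain ⟨n, rfl⟩ : ∃ m, n = m + 1 := ⟨n - 1, by omega⟩
  by_cases hA : MaxPlus.maxCycleMean A = ⊥
  · obtain ⟨h1, h2⟩ := key 0 fun t _ => MaxPlus.weakCSR_of_eq_bot hA t
    have h3 : sInf S = 0 := Nat.le_zero.1 h2
    refine ⟨sInf S, h1, h3 ▸ Nat.zero_le _, ?_, ?_⟩
    · rw [h3]; push_cast
      have : (0 : ℤ) ≤ n * c := by positivity
      rw [add_sub_cancel_right]
      exact add_nonneg this (le_min (by positivity) (by positivity))
    · rw [h3]
      -- The integer `d + c - 1` can be negative only when `c = 0`, and then it is multiplied by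
      -- zero.
      rcases Nat.eq_zero_or_pos c with rfl | hpos
      · simp only [Nat.cast_zero, mul_zero]; positivity
      · have : (0 : ℤ) ≤ ((d : ℤ) + c - 1) * c := mul_nonneg (by omega) (by positivity)
        push_cast
        linarith
  · obtain ⟨l, hl⟩ := WithBot.ne_bot_iff_exists.1 hA
    have hl := hl.symm
    have hc1 : 1 ≤ c := hc ▸ MaxPlus.one_le_circumference hl
    have hlarge : ∀ T, (∀ t, T ≤ t → MaxPlus.IsLarge (n + 1) c d t) → T ∈ S := fun T h t htT =>
      MaxPlus.weakCSR_of_isLarge hl (by rw [← hc, ← hd]; exact h t htT)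
    obtain ⟨h0, h1⟩ := key _ (hlarge (MaxPlus.wielandt (n + 1)) fun t ht => Or.inl ht)
    refine ⟨sInf S, h0, h1, ?_, ?_⟩
    · have h2 := (key _ (hlarge (n * c + (n + 1)) fun t ht => Or.inr (Or.inl ht))).2
      have h3 := (key _ (hlarge ((n + 1) * c + d + 1)
        fun t ht => Or.inr (Or.inr (Or.inl ht)))).2
      have h2' : ((sInf S : ℕ) : ℤ) ≤ n * c + (n + 1) := by exact_mod_cast h2
      have h3' : ((sInf S : ℕ) : ℤ) ≤ (n + 1) * c + d + 1 := by exact_mod_cast h3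
      push_cast
      rw [add_sub_cancel_right, ← min_add_add_left]
      exact le_min h2' (by linarith)
    -- Loop removal gives the threshold `c * d + c + d` for the original `c`, which is smaller than
    -- the claimed bound by `(c - 1) ^ 2`.
    · obtain ⟨c, rfl⟩ : ∃ m, c = m + 1 := ⟨c - 1, by omega⟩
      have h2 := (key _ (hlarge (c * (d + 1) + 2 * d + 1)
        fun t ht => Or.inr (Or.inr (Or.inr ht)))).2
      have h2' : ((sInf S : ℕ) : ℤ) ≤ c * (d + 1) + 2 * d + 1 := by exact_mod_cast h2
      push_cast
      nlinarith [sq_nonneg (c : ℤ)]
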